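/- Let $N\ge 1$, let $\Omega\subset\mathbb{R}^N$ be a bounded open set, let $\beta>1$, and let $f\in L^1(\Omega)$ with $f\ge 0$ a.e. in $\Omega$. Call $u$ a solution if (i) $u\in H^1_{loc}(\Omega)$ and $\operatorname{ess\,inf}_K u>0$ for every compact set $K\subset\Omega$; (ii) $-\Delta u=f/u^{\beta}$ weakly in $\Omega$, that is, $\int_\Omega \nabla u\cdot\nabla\varphi\,dx=\int_\Omega \frac{f}{u^{\beta}}\,\varphi\,dx$ for every $\varphi\in C^1_c(\Omega)$; (iii) $u=0$ on $\partial\Omega$ in the sense that $u\ge 0$ a.e. in $\Omega$ and $(u-\varepsilon)^+:=\max\{u-\varepsilon,0\}\in H^1_0(\Omega)$ for every $\varepsilon>0$. Here $H^1_0(\Omega)$ is the closure of $C_c^\infty(\Omega)$ in $H^1(\Omega)$. Then there is at most one solution: if $u$ and $v$ are two solutions, then $u=v$ a.e. in $\Omega$. -/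

import Mathlib

open MeasureTheory Filter
open scoped ContDiff Topology

namespace SingularElliptic

/-- `φ ∈ C_c^k(Ω)`: a `C^k` function on `ℝ^N` with compact support contained in `Ω`. -/
structure IsTestFunction {N : ℕ} (k : ℕ∞) (Ω : Set (EuclideanSpace ℝ (Fin N)))
    (φ : EuclideanSpace ℝ (Fin N) → ℝ) : Prop where
  contDiff : ContDiff ℝ k φ
  hasCompactSupport : HasCompactSupport φ
  tsupport_subset : tsupport φ ⊆ Ω

/-- `w ∈ L²_loc(Ω)`: `w` is square integrable on every compact subset of `Ω`. -/
def MemL2loc {N : ℕ} {F : Type*} [NormedAddCommGroup F] (Ω : Set (EuclideanSpace ℝ (Fin N)))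
    (w : EuclideanSpace ℝ (Fin N) → F) : Prop :=
  ∀ K : Set (EuclideanSpace ℝ (Fin N)), IsCompact K → K ⊆ Ω → MemLp w 2 (volume.restrict K)

/-- `g` is the distributional gradient of `u` in `Ω`:
`∫_Ω u ∂ᵢφ dx = - ∫_Ω gᵢ φ dx` for every `φ ∈ C_c^∞(Ω)` and every coordinate `i`. -/
structure IsWeakGradient {N : ℕ} (Ω : Set (EuclideanSpace ℝ (Fin N)))
    (u : EuclideanSpace ℝ (Fin N) → ℝ)
    (g : EuclideanSpace ℝ (Fin N) → EuclideanSpace ℝ (Fin N)) : Prop where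
  locallyIntegrableOn : LocallyIntegrableOn u Ω volume
  locallyIntegrableOn_grad : LocallyIntegrableOn g Ω volume
  integral_eq : ∀ φ : EuclideanSpace ℝ (Fin N) → ℝ, IsTestFunction ⊤ Ω φ → ∀ i : Fin N,
    ∫ x in Ω, u x * fderiv ℝ φ x (EuclideanSpace.single i 1) = - ∫ x in Ω, g x i * φ x

/-- `u ∈ H¹_loc(Ω)`, with `g = ∇u`. -/
structure HasH1locGradient {N : ℕ} (Ω : Set (EuclideanSpace ℝ (Fin N)))
    (u : EuclideanSpace ℝ (Fin N) → ℝ)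
    (g : EuclideanSpace ℝ (Fin N) → EuclideanSpace ℝ (Fin N)) : Prop where
  memL2loc : MemL2loc Ω u
  memL2loc_grad : MemL2loc Ω g
  isWeakGradient : IsWeakGradient Ω u g

/-- `u ∈ H¹₀(Ω)`: `u` belongs to `H¹(Ω)` and is a limit, in the norm of `H¹(Ω)`, of a sequence
of functions in `C_c^∞(Ω)`. -/
def MemH10 {N : ℕ} (Ω : Set (EuclideanSpace ℝ (Fin N)))
    (u : EuclideanSpace ℝ (Fin N) → ℝ) : Prop :=
  ∃ g : EuclideanSpace ℝ (Fin N) → EuclideanSpace ℝ (Fin N),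
    MemLp u 2 (volume.restrict Ω) ∧ MemLp g 2 (volume.restrict Ω) ∧ IsWeakGradient Ω u g ∧
    ∃ φ : ℕ → EuclideanSpace ℝ (Fin N) → ℝ, (∀ n, IsTestFunction ⊤ Ω (φ n)) ∧
      Tendsto (fun n => eLpNorm (fun x => φ n x - u x) 2 (volume.restrict Ω)) atTop (𝓝 0) ∧
      Tendsto (fun n => eLpNorm (fun x => gradient (φ n) x - g x) 2 (volume.restrict Ω))
        atTop (𝓝 0)

/-- `u > 0` in `Ω`: the essential infimum of `u` over each compact subset of `Ω` is positive. -/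
def LocallyBoundedBelow {N : ℕ} (Ω : Set (EuclideanSpace ℝ (Fin N)))
    (u : EuclideanSpace ℝ (Fin N) → ℝ) : Prop :=
  ∀ K : Set (EuclideanSpace ℝ (Fin N)), IsCompact K → K ⊆ Ω →
    ∃ c : ℝ, 0 < c ∧ ∀ᵐ x ∂(volume.restrict K), c ≤ u x

/-- `u ∈ H¹_loc(Ω)` is a weak solution of `-Δu = f / u^β`, `u > 0` in `Ω`. (All the integrals
converge when `f` is integrable on `Ω`. The weak gradient is unique up to null sets.) -/
def IsWeakSolution {N : ℕ} (Ω : Set (EuclideanSpace ℝ (Fin N)))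
    (f : EuclideanSpace ℝ (Fin N) → ℝ) (β : ℝ) (u : EuclideanSpace ℝ (Fin N) → ℝ) : Prop :=
  LocallyBoundedBelow Ω u ∧
  ∃ g : EuclideanSpace ℝ (Fin N) → EuclideanSpace ℝ (Fin N), HasH1locGradient Ω u g ∧
    ∀ φ : EuclideanSpace ℝ (Fin N) → ℝ, IsTestFunction 1 Ω φ →
      ∫ x in Ω, inner ℝ (g x) (gradient φ x) = ∫ x in Ω, f x / u x ^ β * φ x

/-- `u ≤ 0` on `∂Ω`: `(u - ε)⁺ ∈ H¹₀(Ω)` for every `ε > 0`. -/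
def BoundaryNonpos {N : ℕ} (Ω : Set (EuclideanSpace ℝ (Fin N)))
    (u : EuclideanSpace ℝ (Fin N) → ℝ) : Prop :=
  ∀ ε : ℝ, 0 < ε → MemH10 Ω (fun x => max (u x - ε) 0)

/-- `u = 0` on `∂Ω`: `u` is nonnegative in `Ω` and `u ≤ 0` on `∂Ω`. -/
def ZeroOnBoundary {N : ℕ} (Ω : Set (EuclideanSpace ℝ (Fin N)))
    (u : EuclideanSpace ℝ (Fin N) → ℝ) : Prop :=
  (∀ᵐ x ∂(volume.restrict Ω), 0 ≤ u x) ∧ BoundaryNonpos Ω u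

end SingularElliptic

/-! By symmetry it is enough to show `u - ε ≤ v` a.e. for every `ε > 0` and then let `ε → 0`.
Formally, both equations are tested with `(u - ε - v)⁺`. Where it is positive, `v < u`, so `f / u^β
≤ f / v^β` because `f ≥ 0`; subtracting gives `∫ |∇(u - ε - v)⁺|² ≤ 0`. This function is not
admissible, however: it need not have compact support, and `∇v` is controlled only locally.

The remedy is to take test functions `φₙ → (u - ε)⁺` in `H¹` and to use `zₙ = (min(φₙ, u - ε) - v)⁺`
(`cutDiff`). Since `v ≥ 0`, one has `0 ≤ zₙ ≤ φₙ⁺`, so `zₙ` is bounded with compact support in `Ω`.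
Where the cut-off is active, `∇zₙ` differs from `∇u - ∇v` by `∇φₙ - ∇(u - ε)⁺`; Young's inequality
absorbs this, giving `‖∇zₙ‖² ≤ ‖∇φₙ - ∇(u - ε)⁺‖² → 0` (`integral_sq_cutDiffGrad_le`). The bound
contains no norm of `∇v`, so the behaviour of `v` near `∂Ω` is irrelevant. A Poincaré inequality
with a constant depending only on `Ω` gives `zₙ → 0` in `L²`, while `zₙ → (u - ε - v)⁺` a.e. along a
subsequence.

To justify testing with `zₙ`, Sobolev functions on a compact set are handled as `L²` limits of `C¹`
functions in a prescribed class (`MemH1Closure`). The class carries sign and size bounds through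
differences and positive parts, so that `zₙ` is approximated by `C¹` functions between `0` and
`φₙ⁺`. Mollification puts `u` and `v` into this framework (`HasH1locGradient.memH1Closure`), and
`integral_inner_eq_of_memH1Closure` extends the weak formulation to such limits. -/

namespace SingularElliptic

open scoped ENNReal NNReal Convolution

/-! ### `L²` convergence of products with bounded multipliers -/

section L2

/-- Dominated convergence: `|aₙ - b| ≤ 2`, so `4‖G‖²` dominates the squared difference. -/
theorem tendsto_eLpNorm_smul_sub_smul {α F : Type*} [MeasurableSpace α] {μ : Measure α}
    [NormedAddCommGroup F] [NormedSpace ℝ F] {a : ℕ → α → ℝ} {b : α → ℝ} {G : α → F}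
    (hG : MemLp G 2 μ) (ha : ∀ n, AEStronglyMeasurable (a n) μ)
    (ha_le : ∀ n, ∀ᵐ x ∂μ, |a n x| ≤ 1)
    (hab : ∀ᵐ x ∂μ, Tendsto (fun n => a n x) atTop (𝓝 (b x))) :
    Tendsto (fun n => eLpNorm (fun x => a n x • G x - b x • G x) 2 μ) atTop (𝓝 0) := by
  have hb : AEStronglyMeasurable b μ := aestronglyMeasurable_of_tendsto_ae atTop ha hab
  have hG2 : ∫⁻ x, ‖G x‖ₑ ^ (2 : ℝ) ∂μ ≠ ⊤ := by
    have := (eLpNorm_lt_top_iff_lintegral_rpow_enorm_lt_top (by norm_num) (by norm_num)).1 hG.2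
    simpa using this.ne
  have key : Tendsto (fun n => ∫⁻ x, ‖a n x • G x - b x • G x‖ₑ ^ (2 : ℝ) ∂μ) atTop
      (𝓝 (∫⁻ _, 0 ∂μ)) := by
    refine tendsto_lintegral_of_dominated_convergence' (fun x => 4 * ‖G x‖ₑ ^ (2 : ℝ))
      (fun n => ?_) (fun n => ?_) ?_ ?_
    · exact ((((ha n).smul hG.1).sub (hb.smul hG.1)).enorm.pow_const _)
    · filter_upwards [ha_le n, hab, ae_all_iff.2 ha_le] with x hx hx' hall
      have hbx : |b x| ≤ 1 := le_of_tendsto hx'.abs (Eventually.of_forall hall)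
      have h2 : ‖a n x - b x‖ₑ ≤ 2 := by
        have h3 : |a n x - b x| ≤ 2 := (abs_sub _ _).trans (by linarith)
        rw [Real.enorm_eq_ofReal_abs]
        exact ENNReal.ofReal_le_of_le_toReal (by simpa using h3)
      rw [← sub_smul, enorm_smul, ENNReal.mul_rpow_of_nonneg _ _ (by norm_num)]
      gcongr
      calc ‖a n x - b x‖ₑ ^ (2 : ℝ) ≤ 2 ^ (2 : ℝ) := by gcongr
        _ = 4 := by norm_num
    · rw [lintegral_const_mul' _ _ (by norm_num)]
      exact ENNReal.mul_ne_top (by norm_num) hG2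
    · filter_upwards [hab] with x hx
      have : Tendsto (fun n => a n x • G x - b x • G x) atTop (𝓝 0) := by
        simpa using (hx.smul_const (G x)).sub_const (b x • G x)
      have := (this.enorm).ennrpow_const 2
      simpa using this
  simp only [lintegral_zero] at key
  have := key.ennrpow_const (1 / 2)
  simp only [eLpNorm_eq_lintegral_rpow_enorm_toReal (show (2 : ℝ≥0∞) ≠ 0 by norm_num)
    (show (2 : ℝ≥0∞) ≠ ⊤ by norm_num)]
  simpa using this

theorem tendsto_eLpNorm_smul_sub {α F : Type*} [MeasurableSpace α] {μ : Measure α}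
    [NormedAddCommGroup F] [NormedSpace ℝ F] {a : ℕ → α → ℝ} {b : α → ℝ} {G : α → F}
    {g : ℕ → α → F} (hG : MemLp G 2 μ) (hg : ∀ n, AEStronglyMeasurable (g n) μ)
    (hgG : Tendsto (fun n => eLpNorm (fun x => g n x - G x) 2 μ) atTop (𝓝 0))
    (ha : ∀ n, AEStronglyMeasurable (a n) μ) (ha_le : ∀ n, ∀ᵐ x ∂μ, |a n x| ≤ 1)
    (hab : ∀ᵐ x ∂μ, Tendsto (fun n => a n x) atTop (𝓝 (b x))) :
    Tendsto (fun n => eLpNorm (fun x => a n x • g n x - b x • G x) 2 μ) atTop (𝓝 0) := by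
  have h1 := tendsto_eLpNorm_smul_sub_smul hG ha ha_le hab
  have hb : AEStronglyMeasurable b μ := aestronglyMeasurable_of_tendsto_ae atTop ha hab
  have h2 := hgG.add h1
  rw [add_zero] at h2
  refine tendsto_of_tendsto_of_tendsto_of_le_of_le tendsto_const_nhds h2 (fun _ => zero_le)
    fun n => ?_
  have : (fun x => a n x • g n x - b x • G x)
      = (fun x => a n x • (g n x - G x)) + fun x => a n x • G x - b x • G x := by
    ext x; simp [smul_sub]
  rw [this]
  refine (eLpNorm_add_le ((ha n).smul ((hg n).sub hG.1))
    (((ha n).smul hG.1).sub (hb.smul hG.1)) (by norm_num)).trans ?_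
  refine add_le_add (eLpNorm_mono_ae ?_) le_rfl
  filter_upwards [ha_le n] with x hx
  rw [Pi.smul_apply', norm_smul]
  exact mul_le_of_le_one_left (norm_nonneg _) hx

end L2

/-! ### Translation and mollification in `L²` -/

section Mollification

variable {E : Type*} [NormedAddCommGroup E] [InnerProductSpace ℝ E] [FiniteDimensional ℝ E]
  [MeasurableSpace E] [BorelSpace E]

theorem exists_eLpNorm_translate_sub_le {F : Type*} [NormedAddCommGroup F] {f : E → F}
    (hf : MemLp f 2 volume) {δ : ℝ≥0∞} (hδ : δ ≠ 0) :
    ∃ r > 0, ∀ t : E, ‖t‖ ≤ r → eLpNorm (fun x => f (x - t) - f x) 2 volume ≤ δ := by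
  have : Fact ((2 : ℝ≥0∞) ≠ ⊤) := ⟨by norm_num⟩
  have hc : Continuous fun t : E => (DomAddAct.mk (-t) : Eᵈᵃᵃ) +ᵥ hf.toLp f := by
    have : Continuous fun t : E => (DomAddAct.mk (-t) : Eᵈᵃᵃ) :=
      DomAddAct.continuous_mk.comp continuous_neg
    exact this.vadd continuous_const
  have h0 := hc.tendsto 0
  have := (EMetric.tendsto_nhds.1 h0) δ (pos_iff_ne_zero.2 hδ)
  obtain ⟨r, hr, hr'⟩ := Metric.eventually_nhds_iff.1 this
  refine ⟨r / 2, by positivity, fun t ht => ?_⟩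
  have h := (hr' (y := t) (by simpa using by linarith)).le
  rw [DomAddAct.mk_vadd_toLp, DomAddAct.mk_vadd_toLp, Lp.edist_toLp_toLp] at h
  have e : (fun x => f (x - t) - f x)
      = (fun x => f (-t +ᵥ x)) - fun x => f (-(0 : E) +ᵥ x) := by
    ext x
    simp [vadd_eq_add, sub_eq_neg_add]
  rwa [e]

/-- Cauchy–Schwarz after writing `w F = w^(1/2) · (w^(1/2) F)`. -/
theorem sq_lintegral_mul_le {α : Type*} [MeasurableSpace α] {μ : Measure α} {w F : α → ℝ≥0∞}
    (hw : AEMeasurable w μ) (hF : AEMeasurable F μ) (hw1 : ∫⁻ x, w x ∂μ ≤ 1) :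
    (∫⁻ x, w x * F x ∂μ) ^ (2 : ℝ) ≤ ∫⁻ x, w x * F x ^ (2 : ℝ) ∂μ := by
  have h := ENNReal.lintegral_mul_le_Lp_mul_Lq μ Real.HolderConjugate.two_two
    (hw.pow_const (1 / 2 : ℝ)) ((hw.pow_const (1 / 2 : ℝ)).mul hF)
  have e1 : ∀ x, (w x ^ (1 / 2 : ℝ)) ^ (2 : ℝ) = w x := fun x => by
    rw [← ENNReal.rpow_mul]; norm_num
  have e2 : ∀ x, w x ^ (1 / 2 : ℝ) * (w x ^ (1 / 2 : ℝ) * F x) = w x * F x := fun x => by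
    rw [← mul_assoc, ← ENNReal.rpow_add_of_nonneg _ _ (by norm_num) (by norm_num)]; norm_num
  have e3 : ∀ x, (w x ^ (1 / 2 : ℝ) * F x) ^ (2 : ℝ) = w x * F x ^ (2 : ℝ) := fun x => by
    rw [ENNReal.mul_rpow_of_nonneg _ _ (by norm_num), e1]
  simp only [Pi.mul_apply, e1, e2, e3] at h
  calc (∫⁻ x, w x * F x ∂μ) ^ (2 : ℝ)
      ≤ (1 * (∫⁻ x, w x * F x ^ (2 : ℝ) ∂μ) ^ (1 / 2 : ℝ)) ^ (2 : ℝ) := by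
        gcongr
        refine h.trans ?_
        gcongr
        exact ENNReal.rpow_le_one hw1 (by norm_num)
    _ = _ := by rw [one_mul, ← ENNReal.rpow_mul]; norm_num

/-- As `η` has mass one, the error is an `η`-average of `f (x - t) - f x`. The square is moved
inside the average by `sq_lintegral_mul_le`, and Tonelli reduces the bound to single translations
with `‖t‖ ≤ r`. -/
theorem eLpNorm_mollify_sub_le {F : Type*} [NormedAddCommGroup F] [NormedSpace ℝ F]
    [CompleteSpace F] {f : E → F} (hf : MemLp f 2 volume) {δ : ℝ≥0∞}
    {r : ℝ} (hr : ∀ t : E, ‖t‖ ≤ r → eLpNorm (fun x => f (x - t) - f x) 2 volume ≤ δ)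
    {η : E → ℝ} (hη : Continuous η) (hη0 : ∀ x, 0 ≤ η x) (hηc : HasCompactSupport η)
    (hη1 : ∫ x, η x = 1) (hηr : ∀ x, r < ‖x‖ → η x = 0) :
    eLpNorm (fun x => (∫ t, η t • f (x - t)) - f x) 2 volume ≤ δ := by
  -- Tonelli needs joint measurability of `(x, t) ↦ f (x - t)`, hence a strongly measurable
  -- representative.
  wlog hfm : StronglyMeasurable f generalizing f
  · have hae : f =ᵐ[volume] hf.1.mk f := hf.1.ae_eq_mk
    have htr : ∀ x, ∀ᵐ t, f (x - t) = hf.1.mk f (x - t) := fun x =>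
      (quasiMeasurePreserving_sub_left_of_right_invariant volume x).ae hae
    have htr' : ∀ t, ∀ᵐ x, f (x - t) = hf.1.mk f (x - t) := fun t =>
      (measurePreserving_sub_right volume t).quasiMeasurePreserving.ae hae
    have := this (f := hf.1.mk f) (hf.ae_eq hae) (fun t ht => by
      rw [← eLpNorm_congr_ae (f := fun x => f (x - t) - f x)]
      · exact hr t ht
      · filter_upwards [hae, htr' t] with x h1 h2
        rw [h1, h2]) hf.1.stronglyMeasurable_mk
    rw [← eLpNorm_congr_ae (f := fun x => (∫ t, η t • f (x - t)) - f x)] at this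
    · exact this
    · filter_upwards [hae] with x h1
      rw [h1]
      congr 1
      refine integral_congr_ae ?_
      filter_upwards [htr x] with t ht
      rw [ht]
  have hηi : Integrable η := hη.integrable_of_hasCompactSupport hηc
  set w : E → ℝ≥0∞ := fun t => ENNReal.ofReal (η t) with hw
  have hwm : Measurable w := hη.measurable.ennreal_ofReal
  have hw1 : ∫⁻ t, w t = 1 := by
    rw [← ofReal_integral_eq_lintegral_ofReal hηi (Eventually.of_forall hη0), hη1]; simp
  have hloc : LocallyIntegrable f volume := hf.locallyIntegrable (by norm_num)
  have hpt : ∀ x, ‖(∫ t, η t • f (x - t)) - f x‖ₑ ≤ ∫⁻ t, w t * ‖f (x - t) - f x‖ₑ := by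
    intro x
    have hint : Integrable fun t => η t • f (x - t) := by
      have := (hηc.convolutionExists_left (ContinuousLinearMap.lsmul ℝ ℝ) hη hloc x).integrable
      simpa using this
    have : (∫ t, η t • f (x - t)) - f x = ∫ t, η t • (f (x - t) - f x) := by
      simp only [smul_sub]
      rw [integral_sub hint (hηi.smul_const _), integral_smul_const, hη1, one_smul]
    rw [this]
    refine (enorm_integral_le_lintegral_enorm _).trans (le_of_eq ?_)
    refine lintegral_congr fun t => ?_
    rw [enorm_smul, Real.enorm_eq_ofReal (hη0 t)]
  have hm2 : Measurable fun p : E × E => w p.2 * ‖f (p.1 - p.2) - f p.1‖ₑ ^ (2 : ℝ) := by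
    refine (hwm.comp measurable_snd).mul ?_
    have h1 : StronglyMeasurable fun p : E × E => f (p.1 - p.2) - f p.1 :=
      (hfm.comp_measurable (measurable_fst.sub measurable_snd)).sub
        (hfm.comp_measurable measurable_fst)
    exact h1.enorm.pow_const _
  have hF2 : ∀ t, w t * ∫⁻ x, ‖f (x - t) - f x‖ₑ ^ (2 : ℝ) ≤ w t * δ ^ (2 : ℝ) := by
    intro t
    by_cases ht : ‖t‖ ≤ r
    · gcongr
      have h := hr t ht
      rw [eLpNorm_eq_lintegral_rpow_enorm_toReal (by norm_num) (by norm_num)] at h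
      have := ENNReal.rpow_le_rpow h (show (0 : ℝ) ≤ 2 by norm_num)
      rw [← ENNReal.rpow_mul] at this
      simpa using this
    · simp [hw, hηr t (not_le.1 ht)]
  rw [eLpNorm_eq_lintegral_rpow_enorm_toReal (by norm_num) (by norm_num)]
  have hmain : ∫⁻ x, ‖(∫ t, η t • f (x - t)) - f x‖ₑ ^ (2 : ℝ) ≤ δ ^ (2 : ℝ) := by
    calc ∫⁻ x, ‖(∫ t, η t • f (x - t)) - f x‖ₑ ^ (2 : ℝ)
        ≤ ∫⁻ x, ∫⁻ t, w t * ‖f (x - t) - f x‖ₑ ^ (2 : ℝ) := by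
          refine lintegral_mono fun x => ?_
          refine (ENNReal.rpow_le_rpow (hpt x) (by norm_num)).trans ?_
          refine sq_lintegral_mul_le hwm.aemeasurable ?_ hw1.le
          have h1 : StronglyMeasurable fun t : E => f (x - t) - f x :=
            (hfm.comp_measurable (measurable_const.sub measurable_id)).sub
              stronglyMeasurable_const
          exact h1.enorm.aemeasurable
      _ = ∫⁻ t, ∫⁻ x, w t * ‖f (x - t) - f x‖ₑ ^ (2 : ℝ) :=
          lintegral_lintegral_swap hm2.aemeasurable
      _ = ∫⁻ t, w t * ∫⁻ x, ‖f (x - t) - f x‖ₑ ^ (2 : ℝ) := by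
          refine lintegral_congr fun t => ?_
          exact lintegral_const_mul' _ _ ENNReal.ofReal_ne_top
      _ ≤ ∫⁻ t, w t * δ ^ (2 : ℝ) := lintegral_mono hF2
      _ = δ ^ (2 : ℝ) := by rw [lintegral_mul_const _ hwm, hw1, one_mul]
  have := ENNReal.rpow_le_rpow hmain (show (0 : ℝ) ≤ 1 / 2 by norm_num)
  rw [← ENNReal.rpow_mul] at this
  simpa using this

end Mollification

/-! ### A `C¹` regularization of the positive part -/

section SmoothPosPart

/-- A `C¹` approximation of the positive part, at scale `δ`. -/
noncomputable def smoothPosPart (δ t : ℝ) : ℝ := ∫ s in (0 : ℝ)..t, Real.smoothTransition (s / δ)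

variable {δ : ℝ}

theorem continuous_smoothTransition_div (δ : ℝ) :
    Continuous fun s : ℝ => Real.smoothTransition (s / δ) :=
  Real.smoothTransition.continuous.comp (continuous_id.div_const δ)

theorem hasDerivAt_smoothPosPart (δ t : ℝ) :
    HasDerivAt (smoothPosPart δ) (Real.smoothTransition (t / δ)) t :=
  intervalIntegral.integral_hasDerivAt_right
    ((continuous_smoothTransition_div δ).intervalIntegrable _ _)
    (continuous_smoothTransition_div δ).stronglyMeasurable.stronglyMeasurableAtFilter
    (continuous_smoothTransition_div δ).continuousAt

theorem contDiff_smoothPosPart (δ : ℝ) : ContDiff ℝ 1 (smoothPosPart δ) := by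
  rw [contDiff_one_iff_deriv]
  refine ⟨fun t => (hasDerivAt_smoothPosPart δ t).differentiableAt, ?_⟩
  have : deriv (smoothPosPart δ) = fun t => Real.smoothTransition (t / δ) :=
    funext fun t => (hasDerivAt_smoothPosPart δ t).deriv
  rw [this]
  exact continuous_smoothTransition_div δ

theorem smoothPosPart_of_nonpos (hδ : 0 < δ) {t : ℝ} (ht : t ≤ 0) : smoothPosPart δ t = 0 := by
  rw [smoothPosPart, intervalIntegral.integral_congr (g := fun _ => 0)]
  · simp
  · intro s hs
    rw [Set.uIcc_of_ge ht] at hs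
    exact Real.smoothTransition.zero_of_nonpos (div_nonpos_of_nonpos_of_nonneg hs.2 hδ.le)

theorem lipschitzWith_smoothPosPart (δ : ℝ) : LipschitzWith 1 (smoothPosPart δ) := by
  refine lipschitzWith_of_nnnorm_deriv_le
    (fun t => (hasDerivAt_smoothPosPart δ t).differentiableAt) fun t => ?_
  rw [(hasDerivAt_smoothPosPart δ t).deriv, ← NNReal.coe_le_coe, coe_nnnorm, Real.norm_eq_abs,
    abs_of_nonneg (Real.smoothTransition.nonneg _)]
  exact Real.smoothTransition.le_one _

theorem monotone_smoothPosPart (δ : ℝ) : Monotone (smoothPosPart δ) :=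
  monotone_of_deriv_nonneg (fun t => (hasDerivAt_smoothPosPart δ t).differentiableAt) fun t => by
    rw [(hasDerivAt_smoothPosPart δ t).deriv]
    exact Real.smoothTransition.nonneg _

theorem smoothPosPart_nonneg (hδ : 0 < δ) (t : ℝ) : 0 ≤ smoothPosPart δ t := by
  rcases le_total t 0 with h | h
  · rw [smoothPosPart_of_nonpos hδ h]
  · rw [← smoothPosPart_of_nonpos hδ (le_refl 0)]
    exact monotone_smoothPosPart δ h

/-- Approximation from below, not mere closeness, is what later keeps approximants between `0` and
`φ⁺`, and hence supported in `tsupport φ`. -/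
theorem smoothPosPart_le_max (hδ : 0 < δ) (t : ℝ) : smoothPosPart δ t ≤ max t 0 := by
  rcases le_total t 0 with h | h
  · rw [smoothPosPart_of_nonpos hδ h]; exact le_max_right _ _
  · have := (lipschitzWith_smoothPosPart δ).dist_le_mul t 0
    rw [Real.dist_eq, Real.dist_eq, smoothPosPart_of_nonpos hδ (le_refl 0), sub_zero, sub_zero,
      abs_of_nonneg h, NNReal.coe_one, one_mul] at this
    exact ((le_abs_self _).trans this).trans (le_max_left _ _)

theorem sub_le_smoothPosPart (hδ : 0 < δ) (t : ℝ) : max t 0 - δ ≤ smoothPosPart δ t := by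
  rcases le_total t δ with h | h
  · have : max t 0 ≤ δ := max_le h hδ.le
    linarith [smoothPosPart_nonneg hδ t]
  · have hi := fun a b => (continuous_smoothTransition_div δ).intervalIntegrable
      (μ := volume) a b
    have h2 : smoothPosPart δ t = smoothPosPart δ δ + (t - δ) := by
      rw [smoothPosPart, ← intervalIntegral.integral_add_adjacent_intervals (hi 0 δ) (hi δ t),
        smoothPosPart, intervalIntegral.integral_congr (a := δ) (b := t) (g := fun _ => 1)]
      · simp
      · intro s hs
        rw [Set.uIcc_of_le h] at hs
        exact Real.smoothTransition.one_of_one_le ((one_le_div hδ).2 hs.1)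
    rw [max_eq_left (hδ.le.trans h), h2]
    linarith [smoothPosPart_nonneg hδ δ]

theorem abs_smoothPosPart_sub_max_le (hδ : 0 < δ) (t : ℝ) :
    |smoothPosPart δ t - max t 0| ≤ δ := by
  rw [abs_le]
  exact ⟨by linarith [sub_le_smoothPosPart hδ t], by linarith [smoothPosPart_le_max hδ t]⟩

/-- The transition vanishes for `t ≤ 0`, so the limit at `t = 0` is `0`; this makes the gradient of
the positive part live on the strict set `{z > 0}`. -/
theorem tendsto_smoothTransition_div {d : ℕ → ℝ} (hd : ∀ n, 0 < d n)
    (hd0 : Tendsto d atTop (𝓝 0)) (t : ℝ) :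
    Tendsto (fun n => Real.smoothTransition (t / d n)) atTop
      (𝓝 (Set.indicator (Set.Ioi (0 : ℝ)) 1 t)) := by
  by_cases ht : 0 < t
  · have : ∀ᶠ n in atTop, Real.smoothTransition (t / d n) = 1 := by
      filter_upwards [hd0.eventually (gt_mem_nhds ht)] with n hn
      exact Real.smoothTransition.one_of_one_le ((one_le_div (hd n)).2 hn.le)
    simpa [ht] using tendsto_const_nhds.congr' (this.mono fun n hn => hn.symm)
  · have : ∀ n, Real.smoothTransition (t / d n) = 0 := fun n =>
      Real.smoothTransition.zero_of_nonpos
        (div_nonpos_of_nonpos_of_nonneg (not_lt.1 ht) (hd n).le)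
    simp [ht, this]

end SmoothPosPart

/-! ### Calculus of `H¹` limits of `C¹` functions in a class -/

section Closure

theorem _root_.Continuous.memLp_two_restrict {X F : Type*} [NormedAddCommGroup X]
    [MeasurableSpace X] [BorelSpace X] [NormedAddCommGroup F] {μ : Measure X}
    [IsFiniteMeasureOnCompacts μ] {K : Set X} {f : X → F} (hf : Continuous f) (hK : IsCompact K) :
    MemLp f 2 (μ.restrict K) := by
  have : IsFiniteMeasure (μ.restrict K) := ⟨by simpa using hK.measure_lt_top⟩
  obtain ⟨C, hC⟩ := hK.exists_bound_of_continuousOn hf.continuousOn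
  refine MemLp.of_bound (hf.continuousOn.aestronglyMeasurable_of_isCompact hK hK.measurableSet) C ?_
  exact (ae_restrict_iff' hK.measurableSet).2 (Eventually.of_forall hC)

variable {E : Type*} [NormedAddCommGroup E] [InnerProductSpace ℝ E] [FiniteDimensional ℝ E]

theorem gradient_comp {S : ℝ → ℝ} {s : ℝ} {ζ : E → ℝ} {x : E} (hS : HasDerivAt S s (ζ x))
    (hζ : DifferentiableAt ℝ ζ x) : gradient (fun y => S (ζ y)) x = s • gradient ζ x := by
  have h := hS.comp_hasFDerivAt x hζ.hasFDerivAt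
  change HasFDerivAt (fun y => S (ζ y)) _ x at h
  rw [gradient, h.fderiv, map_smul, gradient]

theorem gradient_sub {ζ ξ : E → ℝ} {x : E} (hζ : DifferentiableAt ℝ ζ x)
    (hξ : DifferentiableAt ℝ ξ x) :
    gradient (fun y => ζ y - ξ y) x = gradient ζ x - gradient ξ x := by
  rw [gradient, fderiv_fun_sub hζ hξ, map_sub, gradient, gradient]

theorem continuous_gradient {ζ : E → ℝ} (hζ : ContDiff ℝ 1 ζ) : Continuous (gradient ζ) :=
  (InnerProductSpace.toDual ℝ E).symm.continuous.comp (hζ.continuous_fderiv one_ne_zero)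

variable [MeasurableSpace E]

/-- `(z, g)` is a limit in `L²(μ)` of pairs `(ζ, ∇ζ)`, where `ζ` is a `C¹` function in the
class `P`. -/
structure MemH1Closure (μ : Measure E) (P : Set (E → ℝ)) (z : E → ℝ) (g : E → E) : Prop where
  memLp : MemLp z 2 μ
  memLp_grad : MemLp g 2 μ
  exists_approx : ∀ δ : ℝ≥0∞, δ ≠ 0 → ∃ ζ ∈ P, ContDiff ℝ 1 ζ ∧
    eLpNorm (fun x => ζ x - z x) 2 μ ≤ δ ∧ eLpNorm (fun x => gradient ζ x - g x) 2 μ ≤ δ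

variable {μ : Measure E} {P Q R : Set (E → ℝ)} {z w : E → ℝ} {g h : E → E}

theorem exists_subseq_tendsto_ae {α F : Type*} [MeasurableSpace α] [NormedAddCommGroup F]
    {μ : Measure α} {f : ℕ → α → F} {l : α → F} (hf : ∀ n, AEStronglyMeasurable (f n) μ)
    (hl : AEStronglyMeasurable l μ)
    (hfl : Tendsto (fun n => eLpNorm (fun x => f n x - l x) 2 μ) atTop (𝓝 0)) :
    ∃ ns : ℕ → ℕ, StrictMono ns ∧ ∀ᵐ x ∂μ, Tendsto (fun n => f (ns n) x) atTop (𝓝 (l x)) :=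
  (tendstoInMeasure_of_tendsto_eLpNorm (p := 2) (by norm_num) hf hl hfl).exists_seq_tendsto_ae

theorem MemH1Closure.mono (H : MemH1Closure μ P z g) (hPQ : P ⊆ Q) : MemH1Closure μ Q z g where
  memLp := H.memLp
  memLp_grad := H.memLp_grad
  exists_approx δ hδ := by
    obtain ⟨ζ, hP, h⟩ := H.exists_approx δ hδ
    exact ⟨ζ, hPQ hP, h⟩

theorem MemH1Closure.congr (H : MemH1Closure μ P z g) (hzw : z =ᵐ[μ] w) (hgh : g =ᵐ[μ] h) :
    MemH1Closure μ P w h where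
  memLp := (memLp_congr_ae hzw).1 H.memLp
  memLp_grad := (memLp_congr_ae hgh).1 H.memLp_grad
  exists_approx δ hδ := by
    obtain ⟨ζ, hP, hC, h1, h2⟩ := H.exists_approx δ hδ
    refine ⟨ζ, hP, hC, ?_, ?_⟩
    · rwa [eLpNorm_congr_ae (g := fun x => ζ x - z x)]
      filter_upwards [hzw] with x hx
      rw [hx]
    · rwa [eLpNorm_congr_ae (g := fun x => gradient ζ x - g x)]
      filter_upwards [hgh] with x hx
      rw [hx]

theorem MemH1Closure.of_seq {ζ : ℕ → E → ℝ} (hz : MemLp z 2 μ) (hg : MemLp g 2 μ)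
    (hP : ∀ n, ζ n ∈ P) (hC : ∀ n, ContDiff ℝ 1 (ζ n))
    (h1 : Tendsto (fun n => eLpNorm (fun x => ζ n x - z x) 2 μ) atTop (𝓝 0))
    (h2 : Tendsto (fun n => eLpNorm (fun x => gradient (ζ n) x - g x) 2 μ) atTop (𝓝 0)) :
    MemH1Closure μ P z g where
  memLp := hz
  memLp_grad := hg
  exists_approx δ hδ := by
    obtain ⟨n, hn1, hn2⟩ := ((h1.eventually_le_const (pos_iff_ne_zero.2 hδ)).and
      (h2.eventually_le_const (pos_iff_ne_zero.2 hδ))).exists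
    exact ⟨ζ n, hP n, hC n, hn1, hn2⟩

variable [BorelSpace E]

theorem MemH1Closure.exists_seq (H : MemH1Closure μ P z g) :
    ∃ ζ : ℕ → E → ℝ, (∀ n, ζ n ∈ P) ∧ (∀ n, ContDiff ℝ 1 (ζ n)) ∧
      Tendsto (fun n => eLpNorm (fun x => ζ n x - z x) 2 μ) atTop (𝓝 0) ∧
      Tendsto (fun n => eLpNorm (fun x => gradient (ζ n) x - g x) 2 μ) atTop (𝓝 0) ∧
      ∀ᵐ x ∂μ, Tendsto (fun n => ζ n x) atTop (𝓝 (z x)) := by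
  have hpos : ∀ n : ℕ, ((n : ℝ≥0∞) + 1)⁻¹ ≠ 0 := fun n => by simp
  choose ζ hP hC h1 h2 using fun n : ℕ => H.exists_approx _ (hpos n)
  have hlim : Tendsto (fun n : ℕ => ((n : ℝ≥0∞) + 1)⁻¹) atTop (𝓝 0) := by
    have := (tendsto_add_atTop_iff_nat 1).2 ENNReal.tendsto_inv_nat_nhds_zero
    simpa using this
  have t1 := tendsto_of_tendsto_of_tendsto_of_le_of_le tendsto_const_nhds hlim
    (fun _ => zero_le) h1
  have t2 := tendsto_of_tendsto_of_tendsto_of_le_of_le tendsto_const_nhds hlim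
    (fun _ => zero_le) h2
  obtain ⟨ns, hns, hae⟩ := exists_subseq_tendsto_ae
    (fun n => (hC n).continuous.aestronglyMeasurable) H.memLp.1 t1
  exact ⟨fun n => ζ (ns n), fun n => hP _, fun n => hC _, t1.comp hns.tendsto_atTop,
    t2.comp hns.tendsto_atTop, hae⟩

theorem eLpNorm_sub_le_half_add_half {α F : Type*} [MeasurableSpace α] [NormedAddCommGroup F]
    {μ : Measure α} {f k l : α → F} (hf : AEStronglyMeasurable f μ)
    (hk : AEStronglyMeasurable k μ) (hl : AEStronglyMeasurable l μ) {δ : ℝ≥0∞}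
    (hfk : eLpNorm (fun x => f x - k x) 2 μ ≤ δ / 2)
    (hkl : eLpNorm (fun x => k x - l x) 2 μ ≤ δ / 2) :
    eLpNorm (fun x => f x - l x) 2 μ ≤ δ := by
  have : (fun x => f x - l x) = (fun x => f x - k x) + fun x => k x - l x := by
    ext x; simp
  rw [this, ← ENNReal.add_halves δ]
  exact (eLpNorm_add_le (hf.sub hk) (hk.sub hl) (by norm_num)).trans (add_le_add hfk hkl)

theorem MemH1Closure.of_tendsto {zs : ℕ → E → ℝ} {gs : ℕ → E → E}
    (H : ∀ n, MemH1Closure μ P (zs n) (gs n)) (hz : MemLp z 2 μ) (hg : MemLp g 2 μ)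
    (h1 : Tendsto (fun n => eLpNorm (fun x => zs n x - z x) 2 μ) atTop (𝓝 0))
    (h2 : Tendsto (fun n => eLpNorm (fun x => gs n x - g x) 2 μ) atTop (𝓝 0)) :
    MemH1Closure μ P z g where
  memLp := hz
  memLp_grad := hg
  exists_approx δ hδ := by
    have hδ2 : δ / 2 ≠ 0 := by simpa using hδ
    obtain ⟨n, hn1, hn2⟩ := ((h1.eventually_le_const (pos_iff_ne_zero.2 hδ2)).and
      (h2.eventually_le_const (pos_iff_ne_zero.2 hδ2))).exists
    obtain ⟨ζ, hP, hC, h3, h4⟩ := (H n).exists_approx _ hδ2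
    exact ⟨ζ, hP, hC,
      eLpNorm_sub_le_half_add_half hC.continuous.aestronglyMeasurable (H n).memLp.1 hz.1 h3 hn1,
      eLpNorm_sub_le_half_add_half (continuous_gradient hC).aestronglyMeasurable
        (H n).memLp_grad.1 hg.1 h4 hn2⟩

theorem eLpNorm_sub_sub_sub_le {α F : Type*} [MeasurableSpace α] [NormedAddCommGroup F]
    {μ : Measure α} {a b c d : α → F} (ha : AEStronglyMeasurable a μ)
    (hb : AEStronglyMeasurable b μ) (hc : AEStronglyMeasurable c μ)
    (hd : AEStronglyMeasurable d μ) {δ : ℝ≥0∞}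
    (hab : eLpNorm (fun x => a x - b x) 2 μ ≤ δ / 2)
    (hcd : eLpNorm (fun x => c x - d x) 2 μ ≤ δ / 2) :
    eLpNorm (fun x => (a x - c x) - (b x - d x)) 2 μ ≤ δ := by
  have : (fun x => (a x - c x) - (b x - d x)) = (fun x => a x - b x) - fun x => c x - d x := by
    ext x; simp only [Pi.sub_apply]; abel
  rw [this, ← ENNReal.add_halves δ]
  exact (eLpNorm_sub_le (ha.sub hb) (hc.sub hd) (by norm_num)).trans (add_le_add hab hcd)

theorem MemH1Closure.sub (Hz : MemH1Closure μ P z g) (Hw : MemH1Closure μ Q w h)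
    (hR : ∀ p ∈ P, ∀ q ∈ Q, (fun x => p x - q x) ∈ R) :
    MemH1Closure μ R (fun x => z x - w x) (fun x => g x - h x) where
  memLp := Hz.memLp.sub Hw.memLp
  memLp_grad := Hz.memLp_grad.sub Hw.memLp_grad
  exists_approx δ hδ := by
    have hδ2 : δ / 2 ≠ 0 := by simpa using hδ
    obtain ⟨ζ, hP, hC, h1, h2⟩ := Hz.exists_approx _ hδ2
    obtain ⟨ξ, hQ, hD, h3, h4⟩ := Hw.exists_approx _ hδ2
    refine ⟨fun x => ζ x - ξ x, hR _ hP _ hQ, hC.sub hD,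
      eLpNorm_sub_sub_sub_le hC.continuous.aestronglyMeasurable Hz.memLp.1
        hD.continuous.aestronglyMeasurable Hw.memLp.1 h1 h3, ?_⟩
    have : ∀ x, gradient (fun y => ζ y - ξ y) x = gradient ζ x - gradient ξ x := fun x =>
      gradient_sub (hC.differentiable one_ne_zero x) (hD.differentiable one_ne_zero x)
    simp only [this]
    exact eLpNorm_sub_sub_sub_le (continuous_gradient hC).aestronglyMeasurable Hz.memLp_grad.1
      (continuous_gradient hD).aestronglyMeasurable Hw.memLp_grad.1 h2 h4

theorem memH1Closure_of_contDiff [IsFiniteMeasureOnCompacts μ] {K : Set E}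
    {ζ : E → ℝ} (hC : ContDiff ℝ 1 ζ) (hP : ζ ∈ P) (hK : IsCompact K) :
    MemH1Closure (μ.restrict K) P ζ (gradient ζ) where
  memLp := hC.continuous.memLp_two_restrict hK
  memLp_grad := (continuous_gradient hC).memLp_two_restrict hK
  exists_approx δ _ := ⟨ζ, hP, hC, by simp, by simp⟩

/-- The chain rule passes to the limit: the gradients converge in `L²`, while their factors are
bounded by `1` and converge a.e. along a subsequence. -/
theorem MemH1Closure.smoothPosPart_comp (H : MemH1Closure μ P z g) {δ : ℝ} (hδ : 0 < δ)
    (hPQ : ∀ p ∈ P, (fun x => smoothPosPart δ (p x)) ∈ Q) :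
    MemH1Closure μ Q (fun x => smoothPosPart δ (z x))
      (fun x => Real.smoothTransition (z x / δ) • g x) := by
  obtain ⟨ζ, hP, hC, h1, h2, h3⟩ := H.exists_seq
  have hle : ∀ t, |Real.smoothTransition (t / δ)| ≤ 1 := fun t => by
    rw [abs_of_nonneg (Real.smoothTransition.nonneg _)]
    exact Real.smoothTransition.le_one _
  have hgrad : ∀ n x, gradient (fun y => smoothPosPart δ (ζ n y)) x
      = Real.smoothTransition (ζ n x / δ) • gradient (ζ n) x := fun n x =>
    gradient_comp (hasDerivAt_smoothPosPart δ _) ((hC n).differentiable one_ne_zero x)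
  have hlip : ∀ a b, ‖smoothPosPart δ a - smoothPosPart δ b‖ ≤ ‖a - b‖ := fun a b => by
    simpa [dist_eq_norm] using (lipschitzWith_smoothPosPart δ).dist_le_mul a b
  have hmeas : AEStronglyMeasurable (fun x => Real.smoothTransition (z x / δ)) μ :=
    (continuous_smoothTransition_div δ).comp_aestronglyMeasurable H.memLp.1
  refine MemH1Closure.of_seq (ζ := fun n x => smoothPosPart δ (ζ n x)) ?_ ?_
    (fun n => hPQ _ (hP n)) (fun n => (contDiff_smoothPosPart δ).comp (hC n)) ?_ ?_
  · refine H.memLp.mono ((lipschitzWith_smoothPosPart δ).continuous.comp_aestronglyMeasurable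
      H.memLp.1) (Eventually.of_forall fun x => ?_)
    simpa [smoothPosPart_of_nonpos hδ le_rfl] using hlip (z x) 0
  · refine H.memLp_grad.mono (hmeas.smul H.memLp_grad.1) (Eventually.of_forall fun x => ?_)
    rw [norm_smul]
    exact mul_le_of_le_one_left (norm_nonneg _) (hle _)
  · exact tendsto_of_tendsto_of_tendsto_of_le_of_le tendsto_const_nhds h1 (fun _ => zero_le)
      fun n => eLpNorm_mono fun x => hlip _ _
  · simp only [hgrad]
    refine tendsto_eLpNorm_smul_sub (a := fun n x => Real.smoothTransition (ζ n x / δ))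
      H.memLp_grad (fun n => (continuous_gradient (hC n)).aestronglyMeasurable) h2
      (fun n => ((continuous_smoothTransition_div δ).comp (hC n).continuous).aestronglyMeasurable)
      (fun n => Eventually.of_forall fun x => hle _) ?_
    filter_upwards [h3] with x hx
    exact ((continuous_smoothTransition_div δ).tendsto (z x)).comp hx

/-- Let `δ → 0` in the smooth version. The functions converge uniformly, which suffices on a finite
measure; the gradients converge by dominated convergence. -/
theorem MemH1Closure.posPart [IsFiniteMeasure μ] (H : MemH1Closure μ P z g)
    (hPQ : ∀ δ > 0, ∀ p ∈ P, (fun x => smoothPosPart δ (p x)) ∈ Q) :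
    MemH1Closure μ Q (fun x => max (z x) 0) (Set.indicator {x | 0 < z x} g) := by
  set d : ℕ → ℝ := fun n => 1 / ((n : ℝ) + 1) with hd
  have hdpos : ∀ n, 0 < d n := fun n => Nat.one_div_pos_of_nat
  have hd0 : Tendsto d atTop (𝓝 0) := tendsto_one_div_add_atTop_nhds_zero_nat
  have hle : ∀ t, |Real.smoothTransition t| ≤ 1 := fun t => by
    rw [abs_of_nonneg (Real.smoothTransition.nonneg _)]
    exact Real.smoothTransition.le_one _
  have hind : Set.indicator {x | 0 < z x} g
      = fun x => Set.indicator (Set.Ioi (0 : ℝ)) (1 : ℝ → ℝ) (z x) • g x := by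
    ext1 x
    by_cases hx : 0 < z x <;> simp [hx]
  have hnull : NullMeasurableSet {x | 0 < z x} μ :=
    nullMeasurableSet_lt aemeasurable_const H.memLp.1.aemeasurable
  refine MemH1Closure.of_tendsto
    (fun n => H.smoothPosPart_comp (hdpos n) (hPQ _ (hdpos n))) ?_ ?_ ?_ ?_
  · exact H.memLp.sup MemLp.zero
  · exact H.memLp_grad.mono (H.memLp_grad.1.indicator₀ hnull)
      (Eventually.of_forall fun x => norm_indicator_le_norm_self _ _)
  · have hb : ∀ n, eLpNorm (fun x => smoothPosPart (d n) (z x) - max (z x) 0) 2 μ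
        ≤ μ Set.univ ^ ((2 : ℝ≥0∞).toReal)⁻¹ * ENNReal.ofReal (d n) := fun n =>
      eLpNorm_le_of_ae_bound (Eventually.of_forall fun x =>
        abs_smoothPosPart_sub_max_le (hdpos n) (z x))
    refine tendsto_of_tendsto_of_tendsto_of_le_of_le tendsto_const_nhds ?_ (fun _ => zero_le) hb
    have h1 : Tendsto (fun n => ENNReal.ofReal (d n)) atTop (𝓝 0) := by
      simpa using ENNReal.tendsto_ofReal hd0
    have := ENNReal.Tendsto.const_mul (a := μ Set.univ ^ ((2 : ℝ≥0∞).toReal)⁻¹) h1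
      (Or.inr (ENNReal.rpow_ne_top_of_nonneg (by simp) (measure_ne_top _ _)))
    simpa using this
  · rw [hind]
    refine tendsto_eLpNorm_smul_sub_smul H.memLp_grad (fun n => ?_)
      (fun n => Eventually.of_forall fun x => hle _)
      (Eventually.of_forall fun x => tendsto_smoothTransition_div hdpos hd0 (z x))
    exact (continuous_smoothTransition_div (d n)).comp_aestronglyMeasurable H.memLp.1

end Closure

/-! ### Uniqueness of weak gradients and integration by parts -/

section WeakGradient

variable {N : ℕ} {Ω K : Set (EuclideanSpace ℝ (Fin N))}
  {u z : EuclideanSpace ℝ (Fin N) → ℝ}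
  {g g' h : EuclideanSpace ℝ (Fin N) → EuclideanSpace ℝ (Fin N)}

theorem gradient_apply (ζ : EuclideanSpace ℝ (Fin N) → ℝ) (x : EuclideanSpace ℝ (Fin N))
    (i : Fin N) : gradient ζ x i = fderiv ℝ ζ x (EuclideanSpace.single i 1) := by
  rw [← InnerProductSpace.toDual_symm_apply (𝕜 := ℝ), EuclideanSpace.inner_single_right]
  simp [gradient]

theorem tendsto_integral_inner {α F : Type*} [MeasurableSpace α] {μ : Measure α}
    [NormedAddCommGroup F] [InnerProductSpace ℝ F] {f k : ℕ → α → F} {l m : α → F}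
    (hf : ∀ n, MemLp (f n) 2 μ) (hl : MemLp l 2 μ) (hk : ∀ n, MemLp (k n) 2 μ)
    (hm : MemLp m 2 μ)
    (hfl : Tendsto (fun n => eLpNorm (fun x => f n x - l x) 2 μ) atTop (𝓝 0))
    (hkm : Tendsto (fun n => eLpNorm (fun x => k n x - m x) 2 μ) atTop (𝓝 0)) :
    Tendsto (fun n => ∫ x, inner ℝ (f n x) (k n x) ∂μ) atTop
      (𝓝 (∫ x, inner ℝ (l x) (m x) ∂μ)) := by
  have key : ∀ {p q : α → F} (hp : MemLp p 2 μ) (hq : MemLp q 2 μ),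
      ∫ x, inner ℝ (p x) (q x) ∂μ = inner ℝ (hp.toLp p) (hq.toLp q) := fun {p q} hp hq => by
    rw [L2.inner_def]
    refine integral_congr_ae ?_
    filter_upwards [hp.coeFn_toLp, hq.coeFn_toLp] with x h1 h2
    rw [h1, h2]
  rw [key hl hm]
  simp only [fun n => key (hf n) (hk n)]
  exact ((Lp.tendsto_Lp_iff_tendsto_eLpNorm'' f hf l hl).2 hfl).inner
    ((Lp.tendsto_Lp_iff_tendsto_eLpNorm'' k hk m hm).2 hkm)

theorem tendsto_integral_inner_const {α F : Type*} [MeasurableSpace α] {μ : Measure α}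
    [NormedAddCommGroup F] [InnerProductSpace ℝ F] {f : ℕ → α → F} {l k : α → F}
    (hf : ∀ n, MemLp (f n) 2 μ) (hl : MemLp l 2 μ) (hk : MemLp k 2 μ)
    (hfl : Tendsto (fun n => eLpNorm (fun x => f n x - l x) 2 μ) atTop (𝓝 0)) :
    Tendsto (fun n => ∫ x, inner ℝ (f n x) (k x) ∂μ) atTop (𝓝 (∫ x, inner ℝ (l x) (k x) ∂μ)) :=
  tendsto_integral_inner hf hl (fun _ => hk) hk hfl (by simp)

theorem IsTestFunction.integrable_smul {F : Type*} [NormedAddCommGroup F] [NormedSpace ℝ F]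
    {k : ℕ∞} {φ : EuclideanSpace ℝ (Fin N) → ℝ} (hφ : IsTestFunction k Ω φ)
    {f : EuclideanSpace ℝ (Fin N) → F} (hf : LocallyIntegrableOn f Ω volume) :
    Integrable (fun x => φ x • f x) volume := by
  have h1 : IntegrableOn (fun x => φ x • f x) (tsupport φ) volume :=
    (hf.integrableOn_compact_subset hφ.tsupport_subset hφ.hasCompactSupport).continuousOn_smul
      hφ.contDiff.continuous.continuousOn hφ.hasCompactSupport
  rw [← integrableOn_iff_integrable_of_support_subset (s := tsupport φ)]
  · exact h1
  · intro x hx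
    by_contra hx'
    exact hx (by simp [image_eq_zero_of_notMem_tsupport hx'])

/-- The fundamental lemma of the calculus of variations, applied to `g - g'` coordinate by
coordinate. It serves to identify the gradient supplied by `MemH10` with `∇u` where `u > ε`. -/
theorem IsWeakGradient.ae_eq (hΩ : IsOpen Ω) (hg : IsWeakGradient Ω u g)
    (hg' : IsWeakGradient Ω u g') : ∀ᵐ x ∂(volume.restrict Ω), g x = g' x := by
  rw [ae_restrict_iff' hΩ.measurableSet]
  have hloc := hg.locallyIntegrableOn_grad.sub hg'.locallyIntegrableOn_grad
  have := hΩ.ae_eq_zero_of_integral_contDiff_smul_eq_zero hloc fun φ hφ hc hs => by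
    have ht : IsTestFunction ⊤ Ω φ := ⟨hφ, hc, hs⟩
    have i1 := ht.integrable_smul hg.locallyIntegrableOn_grad
    have i2 := ht.integrable_smul hg'.locallyIntegrableOn_grad
    simp only [Pi.sub_apply, smul_sub]
    rw [integral_sub i1 i2, sub_eq_zero]
    have hcoord : ∀ {q : EuclideanSpace ℝ (Fin N) → EuclideanSpace ℝ (Fin N)},
        Integrable (fun x => φ x • q x) volume → ∀ i,
        (∫ x, φ x • q x) i = ∫ x in Ω, q x i * φ x := fun {q} hq i => by
      have h1 := ((EuclideanSpace.proj i : EuclideanSpace ℝ (Fin N) →L[ℝ] ℝ).integral_comp_comm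
        hq).symm
      rw [setIntegral_eq_integral_of_forall_compl_eq_zero]
      · simpa [mul_comm] using h1
      · intro x hx
        simp [image_eq_zero_of_notMem_tsupport fun h => hx (hs h)]
    ext i
    rw [hcoord i1, hcoord i2, ← neg_inj, ← hg.integral_eq φ ht i, ← hg'.integral_eq φ ht i]
  filter_upwards [this] with x hx hxΩ
  exact sub_eq_zero.1 (hx hxΩ)

theorem integral_mul_fderiv_of_contDiff {ζ φ : EuclideanSpace ℝ (Fin N) → ℝ}
    (hζ : ContDiff ℝ 1 ζ) (hφ : ContDiff ℝ 1 φ) (hc : HasCompactSupport φ)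
    (v : EuclideanSpace ℝ (Fin N)) :
    ∫ x, ζ x * fderiv ℝ φ x v = - ∫ x, fderiv ℝ ζ x v * φ x := by
  have hφ' : Continuous fun x => fderiv ℝ φ x v :=
    (hφ.continuous_fderiv one_ne_zero).clm_apply continuous_const
  have hζ' : Continuous fun x => fderiv ℝ ζ x v :=
    (hζ.continuous_fderiv one_ne_zero).clm_apply continuous_const
  refine integral_mul_fderiv_eq_neg_fderiv_mul_of_integrable ?_ ?_ ?_
    (fun x _ => hζ.differentiable one_ne_zero x) (fun x _ => hφ.differentiable one_ne_zero x)
  · exact (hζ'.mul hφ.continuous).integrable_of_hasCompactSupport hc.mul_left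
  · exact (hζ.continuous.mul hφ').integrable_of_hasCompactSupport
      ((hc.fderiv_apply ℝ v).mul_left)
  · exact (hζ.continuous.mul hφ.continuous).integrable_of_hasCompactSupport hc.mul_left

theorem MemH1Closure.integral_mul_fderiv {P : Set (EuclideanSpace ℝ (Fin N) → ℝ)}
    (hK : IsCompact K) (H : MemH1Closure (volume.restrict K) P z h)
    {φ : EuclideanSpace ℝ (Fin N) → ℝ} (hφ : ContDiff ℝ 1 φ) (hφK : tsupport φ ⊆ K) (i : Fin N) :
    ∫ x in K, z x * fderiv ℝ φ x (EuclideanSpace.single i 1) = - ∫ x in K, h x i * φ x := by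
  obtain ⟨ζ, -, hC, h1, h2, -⟩ := H.exists_seq
  have hc : HasCompactSupport φ := hK.of_isClosed_subset (isClosed_tsupport φ) hφK
  set v : EuclideanSpace ℝ (Fin N) := EuclideanSpace.single i 1
  have hφ' : Continuous fun x => fderiv ℝ φ x v :=
    (hφ.continuous_fderiv one_ne_zero).clm_apply continuous_const
  have t1 := tendsto_integral_inner_const (fun n => (hC n).continuous.memLp_two_restrict hK) H.memLp
    (hφ'.memLp_two_restrict hK) h1
  have t2 := tendsto_integral_inner_const (k := fun x => φ x • v)
    (fun n => (continuous_gradient (hC n)).memLp_two_restrict hK) H.memLp_grad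
    ((hφ.continuous.smul continuous_const).memLp_two_restrict hK) h2
  have e2 : ∀ (a : EuclideanSpace ℝ (Fin N)) (b : ℝ), inner ℝ a (b • v) = a i * b := fun a b => by
    rw [inner_smul_right, EuclideanSpace.inner_single_right]
    simp [mul_comm]
  simp only [RCLike.inner_apply, conj_trivial, mul_comm (fderiv ℝ φ _ v)] at t1
  simp only [e2] at t2
  have hn : ∀ n, ∫ x in K, ζ n x * fderiv ℝ φ x v = - ∫ x in K, gradient (ζ n) x i * φ x := by
    intro n
    rw [setIntegral_eq_integral_of_forall_compl_eq_zero,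
      setIntegral_eq_integral_of_forall_compl_eq_zero,
      integral_mul_fderiv_of_contDiff (hC n) hφ hc]
    · simp only [gradient_apply, v]
    · intro x hx
      simp [image_eq_zero_of_notMem_tsupport fun h => hx (hφK h)]
    · intro x hx
      have : fderiv ℝ φ x = 0 := image_eq_zero_of_notMem_tsupport
        fun h => hx (hφK (tsupport_fderiv_subset ℝ h))
      simp [this]
  simp only [hn] at t1
  exact tendsto_nhds_unique t1 t2.neg

end WeakGradient

/-! ### Local approximation of `H¹_loc` functions by mollification -/

section Regularization

variable {N : ℕ} {Ω K : Set (EuclideanSpace ℝ (Fin N))}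
  {u : EuclideanSpace ℝ (Fin N) → ℝ}
  {g : EuclideanSpace ℝ (Fin N) → EuclideanSpace ℝ (Fin N)}

/-- The derivative falls on `η`, and `y ↦ η (x - y)` is a test function for the weak gradient. Its
support lies in the closed ball of radius `r` about `x`, hence in `L`, so truncation to `L` is
harmless. -/
theorem IsWeakGradient.fderiv_convolution (hg : IsWeakGradient Ω u g)
    {L : Set (EuclideanSpace ℝ (Fin N))} (hL : IsCompact L) (hLΩ : L ⊆ Ω)
    {η : EuclideanSpace ℝ (Fin N) → ℝ} (hη : ContDiff ℝ ∞ η) (hηc : HasCompactSupport η)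
    {r : ℝ} (hηr : tsupport η ⊆ Metric.closedBall 0 r)
    {x : EuclideanSpace ℝ (Fin N)} (hx : Metric.closedBall x r ⊆ L) :
    gradient (fun y => ∫ t, η t • L.indicator u (y - t)) x
      = ∫ t, η t • L.indicator g (x - t) := by
  have hui : IntegrableOn u L := hg.locallyIntegrableOn.integrableOn_compact_subset hLΩ hL
  have hgi : IntegrableOn g L := hg.locallyIntegrableOn_grad.integrableOn_compact_subset hLΩ hL
  have hu : Integrable (L.indicator u) := hui.integrable_indicator hL.measurableSet
  have hgI : Integrable (L.indicator g) := hgi.integrable_indicator hL.measurableSet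
  have hη1 : ContDiff ℝ 1 η := hη.of_le (by exact_mod_cast le_top)
  set φ : EuclideanSpace ℝ (Fin N) → ℝ := fun y => η (x - y) with hφ
  have hφs : tsupport φ ⊆ L := by
    refine (closure_minimal (fun y hy => ?_) Metric.isClosed_closedBall).trans hx
    have : x - y ∈ Metric.closedBall (0 : EuclideanSpace ℝ (Fin N)) r :=
      hηr (subset_tsupport η hy)
    rw [mem_closedBall_zero_iff] at this
    rwa [Metric.mem_closedBall, dist_comm, dist_eq_norm]
  have htest : IsTestFunction ⊤ Ω φ :=
    ⟨hη.comp (contDiff_const.sub contDiff_id),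
      hL.of_isClosed_subset (isClosed_tsupport φ) hφs, hφs.trans hLΩ⟩
  have hφd : ∀ y v, fderiv ℝ φ y v = - fderiv ℝ η (x - y) v := fun y v => by
    have h1 : HasFDerivAt (fun y => x - y)
        (-ContinuousLinearMap.id ℝ (EuclideanSpace ℝ (Fin N))) y := by
      simpa using (hasFDerivAt_id y).const_sub x
    have h2 : HasFDerivAt φ _ y :=
      ((hη1.differentiable one_ne_zero (x - y)).hasFDerivAt).comp y h1
    rw [h2.fderiv]
    simp
  have hconv : (fun y => ∫ t, η t • L.indicator u (y - t))
      = L.indicator u ⋆[ContinuousLinearMap.lsmul ℝ ℝ, volume] η := by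
    ext y
    rw [convolution_eq_swap]
    simp [mul_comm]
  have hd := hηc.hasFDerivAt_convolution_right (ContinuousLinearMap.lsmul ℝ ℝ)
    hu.locallyIntegrable hη1 x
  have hint : Integrable fun t => η t • L.indicator g (x - t) := by
    have := (hηc.convolutionExists_left (ContinuousLinearMap.lsmul ℝ ℝ) hη.continuous
      hgI.locallyIntegrable x).integrable
    simpa using this
  ext i
  have hcoord := ((EuclideanSpace.proj i : EuclideanSpace ℝ (Fin N) →L[ℝ] ℝ).integral_comp_comm
        hint)
  simp only [PiLp.proj_apply] at hcoord
  rw [gradient_apply, hconv, hd.fderiv, convolution_precompR_apply _ hu.locallyIntegrable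
    (hηc.fderiv ℝ) (hη1.continuous_fderiv one_ne_zero), convolution_def, ← hcoord,
    ← integral_sub_left_eq_self (fun t => (η t • L.indicator g (x - t)) i) volume x]
  have hw := hg.integral_eq φ htest i
  rw [setIntegral_eq_integral_of_forall_compl_eq_zero,
    setIntegral_eq_integral_of_forall_compl_eq_zero, eq_neg_iff_add_eq_zero,
    add_comm, ← eq_neg_iff_add_eq_zero, ← integral_neg] at hw
  · rw [show (∫ t, (η (x - t) • L.indicator g (x - (x - t))) i) = ∫ y, g y i * φ y from ?_, hw]
    · refine integral_congr_ae (Eventually.of_forall fun y => ?_)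
      simp only [hφd, ContinuousLinearMap.lsmul_apply, smul_eq_mul]
      by_cases hy : y ∈ L
      · simp [hy]
      · have : fderiv ℝ φ y (EuclideanSpace.single i 1) = 0 := by
          rw [show fderiv ℝ φ y = 0 from image_eq_zero_of_notMem_tsupport
            fun h => hy (hφs (tsupport_fderiv_subset ℝ h))]
          simp
        rw [hφd] at this
        rw [this]
        simp [hy]
    · refine integral_congr_ae (Eventually.of_forall fun y => ?_)
      simp only [sub_sub_cancel]
      by_cases hy : y ∈ L
      · simp [hy, hφ, mul_comm]
      · have : φ y = 0 := image_eq_zero_of_notMem_tsupport fun h => hy (hφs h)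
        simp [hy, this]
  · intro y hy
    simp [image_eq_zero_of_notMem_tsupport (f := φ) fun h => hy (hLΩ (hφs h))]
  · intro y hy
    rw [show fderiv ℝ φ y = 0 from image_eq_zero_of_notMem_tsupport
            fun h => hy (hLΩ (hφs (tsupport_fderiv_subset ℝ h)))]
    simp

/-- Averaging against a nonnegative kernel preserves the sign. The class states this conditionally,
so the result also serves functions not known to be nonnegative. -/
theorem HasH1locGradient.memH1Closure (hΩ : IsOpen Ω) (H : HasH1locGradient Ω u g)
    (hK : IsCompact K) (hKΩ : K ⊆ Ω) :
    MemH1Closure (volume.restrict K)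
      {ζ | (∀ᵐ x ∂(volume.restrict Ω), 0 ≤ u x) → ∀ x, 0 ≤ ζ x} u g where
  memLp := H.memL2loc K hK hKΩ
  memLp_grad := H.memL2loc_grad K hK hKΩ
  exists_approx δ hδ := by
    obtain ⟨ρ, hρ, hρΩ⟩ := hK.exists_cthickening_subset_open hΩ hKΩ
    set L := Metric.cthickening ρ K with hLdef
    have hL : IsCompact L := hK.cthickening
    have hu : MemLp (L.indicator u) 2 volume :=
      (memLp_indicator_iff_restrict hL.measurableSet).2 (H.memL2loc L hL hρΩ)
    have hg : MemLp (L.indicator g) 2 volume :=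
      (memLp_indicator_iff_restrict hL.measurableSet).2 (H.memL2loc_grad L hL hρΩ)
    obtain ⟨r₁, hr₁, h1⟩ := exists_eLpNorm_translate_sub_le hu hδ
    obtain ⟨r₂, hr₂, h2⟩ := exists_eLpNorm_translate_sub_le hg hδ
    -- One radius does three jobs: balls about points of `K` stay in `L`, and a single mollifier is
    -- `δ`-accurate for both the function and its gradient.
    set r := min ρ (min r₁ r₂) with hr
    have hrpos : 0 < r := lt_min hρ (lt_min hr₁ hr₂)
    let b : ContDiffBump (0 : EuclideanSpace ℝ (Fin N)) := ⟨r / 2, r, by positivity, by linarith⟩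
    set η := b.normed volume with hη
    have hηC : ContDiff ℝ ∞ η := b.contDiff_normed
    have hηc : HasCompactSupport η := b.hasCompactSupport_normed
    have hηs : tsupport η = Metric.closedBall 0 r := b.tsupport_normed_eq
    have hη0 : ∀ x, r < ‖x‖ → η x = 0 := fun x hx =>
      image_eq_zero_of_notMem_tsupport (by rw [hηs]; simpa using hx)
    have hKL : K ⊆ L := Metric.self_subset_cthickening K
    have hball : ∀ x ∈ K, Metric.closedBall x r ⊆ L := fun x hx =>
      (Metric.closedBall_subset_closedBall (min_le_left _ _)).trans
        (Metric.closedBall_subset_cthickening hx ρ)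
    refine ⟨fun y => ∫ t, η t • L.indicator u (y - t), fun hpos x => ?_, ?_, ?_, ?_⟩
    · refine integral_nonneg_of_ae ?_
      have hLu : ∀ᵐ y, 0 ≤ L.indicator u y := by
        rw [ae_restrict_iff' hΩ.measurableSet] at hpos
        filter_upwards [hpos] with y hy
        by_cases hyL : y ∈ L
        · simpa [hyL] using hy (hρΩ hyL)
        · simp [hyL]
      filter_upwards [(quasiMeasurePreserving_sub_left_of_right_invariant volume x).ae hLu]
        with t ht
      exact mul_nonneg (b.nonneg_normed t) ht
    · have : (fun y => ∫ t, η t • L.indicator u (y - t))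
          = η ⋆[ContinuousLinearMap.lsmul ℝ ℝ, volume] L.indicator u := by
        ext y
        simp [convolution_def]
      rw [this]
      exact hηc.contDiff_convolution_left _ (n := 1) (hηC.of_le (by exact_mod_cast le_top))
        (hu.locallyIntegrable (by norm_num))
    · refine le_trans (le_of_eq_of_le (eLpNorm_congr_ae ?_) (eLpNorm_mono_measure _
        (Measure.restrict_le_self (s := K)))) (eLpNorm_mollify_sub_le hu
          (fun t ht => h1 t (ht.trans ((min_le_right _ _).trans (min_le_left _ _))))
          hηC.continuous b.nonneg_normed hηc b.integral_normed hη0)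
      filter_upwards [ae_restrict_mem hK.measurableSet] with x hx
      simp [hKL hx]
    · refine le_trans (le_of_eq_of_le (eLpNorm_congr_ae ?_) (eLpNorm_mono_measure _
        (Measure.restrict_le_self (s := K)))) (eLpNorm_mollify_sub_le hg
          (fun t ht => h2 t (ht.trans ((min_le_right _ _).trans (min_le_right _ _))))
          hηC.continuous b.nonneg_normed hηc b.integral_normed hη0)
      filter_upwards [ae_restrict_mem hK.measurableSet] with x hx
      rw [H.isWeakGradient.fderiv_convolution hL hρΩ hηC hηc hηs.le (hball x hx)]
      simp [hKL hx]

end Regularization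

/-! ### Poincaré inequality -/

section Poincare

variable {N : ℕ} {K : Set (EuclideanSpace ℝ (Fin N))}

/-- Since `∂ᵢxᵢ = 1`, integration by parts gives `∫ ζ² = -∫ 2 xᵢ ζ ∂ᵢζ`. With `|xᵢ| ≤ R`, Young's
inequality bounds this by `½ ∫ ζ² + 2R² ∫ |∇ζ|²`, and the first term is absorbed. The assumption `1
≤ N` provides the coordinate. -/
theorem integral_sq_le_integral_gradient_sq (hN : 1 ≤ N) {R : ℝ} (hR : 0 ≤ R)
    (hKR : K ⊆ Metric.closedBall 0 R) (hK : IsCompact K) {ζ : EuclideanSpace ℝ (Fin N) → ℝ}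
    (hC : ContDiff ℝ 1 ζ) (hζ : tsupport ζ ⊆ K) :
    ∫ x in K, inner ℝ (ζ x) (ζ x)
      ≤ 4 * R ^ 2 * ∫ x in K, inner ℝ (gradient ζ x) (gradient ζ x) := by
  have hc : HasCompactSupport ζ := hK.of_isClosed_subset (isClosed_tsupport ζ) hζ
  set i : Fin N := ⟨0, hN⟩
  set v : EuclideanSpace ℝ (Fin N) := EuclideanSpace.single i 1 with hv
  set c : EuclideanSpace ℝ (Fin N) → ℝ := fun x => x i with hcdef
  have hcC : ContDiff ℝ 1 c := (EuclideanSpace.proj i : EuclideanSpace ℝ (Fin N) →L[ℝ] ℝ).contDiff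
  have hcd : ∀ x, fderiv ℝ c x v = 1 := fun x => by
    rw [show c = (EuclideanSpace.proj i : EuclideanSpace ℝ (Fin N) →L[ℝ] ℝ) from rfl,
      ContinuousLinearMap.fderiv]
    simp [hv]
  have hsq : ∀ x, fderiv ℝ (fun y => ζ y ^ 2) x v = 2 * ζ x * fderiv ℝ ζ x v := fun x => by
    rw [((hC.differentiable one_ne_zero x).hasFDerivAt.pow 2).fderiv]
    simp
  have hsupp : HasCompactSupport fun y => ζ y ^ 2 := hc.comp_left (g := fun t => t ^ 2) (by simp)
  have hibp := integral_mul_fderiv_of_contDiff hcC (hC.pow 2) hsupp v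
  simp only [hcd, hsq, one_mul] at hibp
  have hζ0 : ∀ x ∉ K, ζ x = 0 := fun x hx =>
    image_eq_zero_of_notMem_tsupport fun h => hx (hζ h)
  have e1 : ∫ x in K, inner ℝ (ζ x) (ζ x) = ∫ x, ζ x ^ 2 := by
    rw [setIntegral_eq_integral_of_forall_compl_eq_zero]
    · simp [pow_two]
    · intro x hx
      simp [hζ0 x hx]
  have e2 : ∫ x, c x * (2 * ζ x * fderiv ℝ ζ x v)
      = ∫ x in K, c x * (2 * ζ x * fderiv ℝ ζ x v) := by
    rw [setIntegral_eq_integral_of_forall_compl_eq_zero]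
    intro x hx
    simp [hζ0 x hx]
  have hI1 : IntegrableOn (fun x => inner ℝ (ζ x) (ζ x)) K :=
    (hC.continuous.inner hC.continuous).continuousOn.integrableOn_compact hK
  have hI2 : IntegrableOn (fun x => inner ℝ (gradient ζ x) (gradient ζ x)) K :=
    ((continuous_gradient hC).inner (continuous_gradient hC)).continuousOn.integrableOn_compact hK
  have hI3 : IntegrableOn (fun x => c x * (2 * ζ x * fderiv ℝ ζ x v)) K :=
    (hcC.continuous.mul ((continuous_const.mul hC.continuous).mul
      ((hC.continuous_fderiv one_ne_zero).clm_apply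
        continuous_const))).continuousOn.integrableOn_compact hK
  have hle : ∫ x in K, -(c x * (2 * ζ x * fderiv ℝ ζ x v))
      ≤ ∫ x in K, (1 / 2 * inner ℝ (ζ x) (ζ x)
        + 2 * R ^ 2 * inner ℝ (gradient ζ x) (gradient ζ x)) := by
    refine setIntegral_mono_on hI3.neg ((hI1.const_mul _).add (hI2.const_mul _))
      hK.measurableSet fun x hx => ?_
    have hcx : |c x| ≤ R := by
      have := mem_closedBall_zero_iff.1 (hKR hx)
      exact (PiLp.norm_apply_le x i).trans this
    have hgx : |fderiv ℝ ζ x v| ≤ ‖gradient ζ x‖ := by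
      rw [hv, ← gradient_apply]
      exact PiLp.norm_apply_le (gradient ζ x) i
    rw [real_inner_self_eq_norm_sq, real_inner_self_eq_norm_sq, Real.norm_eq_abs]
    have h1 : -(c x * (2 * ζ x * fderiv ℝ ζ x v)) ≤ 2 * |ζ x| * (R * ‖gradient ζ x‖) := by
      calc -(c x * (2 * ζ x * fderiv ℝ ζ x v)) ≤ |c x * (2 * ζ x * fderiv ℝ ζ x v)| :=
            neg_le_abs _
        _ = 2 * |ζ x| * (|c x| * |fderiv ℝ ζ x v|) := by
            rw [abs_mul, abs_mul, abs_mul, abs_two]; ring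
        _ ≤ _ := by gcongr
    nlinarith [sq_nonneg (|ζ x| - 2 * (R * ‖gradient ζ x‖))]
  rw [integral_neg, ← e2, hibp, neg_neg, integral_add (hI1.const_mul _) (hI2.const_mul _),
    integral_const_mul, integral_const_mul, ← e1] at hle
  linarith

theorem MemH1Closure.integral_sq_le (hN : 1 ≤ N) {R : ℝ} (hR : 0 ≤ R)
    (hKR : K ⊆ Metric.closedBall 0 R) (hK : IsCompact K) {P : Set (EuclideanSpace ℝ (Fin N) → ℝ)}
    (hP : ∀ ζ ∈ P, tsupport ζ ⊆ K) {z : EuclideanSpace ℝ (Fin N) → ℝ}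
    {h : EuclideanSpace ℝ (Fin N) → EuclideanSpace ℝ (Fin N)}
    (H : MemH1Closure (volume.restrict K) P z h) :
    ∫ x in K, inner ℝ (z x) (z x) ≤ 4 * R ^ 2 * ∫ x in K, inner ℝ (h x) (h x) := by
  obtain ⟨ζ, hζ, hC, h1, h2, -⟩ := H.exists_seq
  have m1 := fun n => (hC n).continuous.memLp_two_restrict (μ := volume) hK
  have m2 := fun n => (continuous_gradient (hC n)).memLp_two_restrict (μ := volume) hK
  exact le_of_tendsto_of_tendsto' (tendsto_integral_inner m1 H.memLp m1 H.memLp h1 h1)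
    ((tendsto_integral_inner m2 H.memLp_grad m2 H.memLp_grad h2 h2).const_mul _)
    fun n => integral_sq_le_integral_gradient_sq hN hR hKR hK (hC n) (hP _ (hζ n))

end Poincare

/-! ### The gradient of `(u - ε)⁺` -/

section PosPartGradient

variable {N : ℕ} {Ω K : Set (EuclideanSpace ℝ (Fin N))}
  {u : EuclideanSpace ℝ (Fin N) → ℝ}
  {g g' : EuclideanSpace ℝ (Fin N) → EuclideanSpace ℝ (Fin N)}

theorem MemH1Closure.sub_const {P : Set (EuclideanSpace ℝ (Fin N) → ℝ)}
    (hK : IsCompact K) (H : MemH1Closure (volume.restrict K) P u g) (ε : ℝ) :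
    MemH1Closure (volume.restrict K) Set.univ (fun x => u x - ε) g := by
  have hc := memH1Closure_of_contDiff (μ := volume) (P := Set.univ)
    (contDiff_const (c := ε) : ContDiff ℝ 1 fun _ : EuclideanSpace ℝ (Fin N) => ε)
    (Set.mem_univ _) hK
  have := H.sub (R := Set.univ) hc fun _ _ _ _ => Set.mem_univ _
  simpa [gradient_fun_const] using this

theorem HasH1locGradient.isWeakGradient_posPart (hΩ : IsOpen Ω) (H : HasH1locGradient Ω u g)
    {ε : ℝ} (hloc : LocallyIntegrableOn (fun x => max (u x - ε) 0) Ω volume) :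
    IsWeakGradient Ω (fun x => max (u x - ε) 0) (Set.indicator {x | 0 < u x - ε} g) where
  locallyIntegrableOn := hloc
  locallyIntegrableOn_grad := by
    have hm : AEStronglyMeasurable u (volume.restrict Ω) :=
      H.isWeakGradient.locallyIntegrableOn.aestronglyMeasurable
    have hgm : AEStronglyMeasurable g (volume.restrict Ω) :=
      H.isWeakGradient.locallyIntegrableOn_grad.aestronglyMeasurable
    have hnull : NullMeasurableSet {x | 0 < u x - ε} (volume.restrict Ω) :=
      nullMeasurableSet_lt aemeasurable_const (hm.aemeasurable.sub_const ε)
    refine (locallyIntegrableOn_iff hΩ.isLocallyClosed).2 fun L hL hLc => ?_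
    exact Integrable.mono
      (H.isWeakGradient.locallyIntegrableOn_grad.integrableOn_compact_subset hL hLc)
      ((hgm.indicator₀ hnull).mono_set hL)
      (Eventually.of_forall fun x => norm_indicator_le_norm_self _ _)
  integral_eq φ hφ i := by
    have hcl := ((H.memH1Closure hΩ hφ.hasCompactSupport hφ.tsupport_subset).sub_const
      hφ.hasCompactSupport ε)
    have : IsFiniteMeasure (volume.restrict (tsupport φ)) :=
      ⟨by simpa using hφ.hasCompactSupport.isCompact.measure_lt_top⟩
    have h1 := (hcl.posPart (Q := Set.univ) fun _ _ _ _ => Set.mem_univ _).integral_mul_fderiv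
      hφ.hasCompactSupport (hφ.contDiff.of_le (by exact_mod_cast le_top)) subset_rfl i
    have h0 : ∀ x ∉ tsupport φ, fderiv ℝ φ x = 0 := fun x hx =>
      image_eq_zero_of_notMem_tsupport fun h => hx (tsupport_fderiv_subset ℝ h)
    have h0' : ∀ x ∉ tsupport φ, φ x = 0 := fun x hx => image_eq_zero_of_notMem_tsupport hx
    rw [setIntegral_eq_integral_of_forall_compl_eq_zero (fun x hx => by simp [h0 x hx]),
      setIntegral_eq_integral_of_forall_compl_eq_zero (fun x hx => by simp [h0' x hx])] at h1
    rwa [setIntegral_eq_integral_of_forall_compl_eq_zero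
        (fun x hx => by simp [h0 x fun h => hx (hφ.tsupport_subset h)]),
      setIntegral_eq_integral_of_forall_compl_eq_zero
        (fun x hx => by simp [h0' x fun h => hx (hφ.tsupport_subset h)])]

theorem HasH1locGradient.ae_eq_grad_posPart (hΩ : IsOpen Ω) (H : HasH1locGradient Ω u g)
    {ε : ℝ} (hg' : IsWeakGradient Ω (fun x => max (u x - ε) 0) g') :
    ∀ᵐ x ∂(volume.restrict Ω), ε < u x → g' x = g x := by
  filter_upwards [hg'.ae_eq hΩ (H.isWeakGradient_posPart hΩ hg'.locallyIntegrableOn)] with x hx hu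
  rw [hx, Set.indicator_of_mem (by simpa using hu)]

end PosPartGradient

/-! ### Enlarging the class of test functions -/

section WeakForm

variable {N : ℕ} {Ω : Set (EuclideanSpace ℝ (Fin N))}
  {f u z φ : EuclideanSpace ℝ (Fin N) → ℝ} {β : ℝ}
  {g h : EuclideanSpace ℝ (Fin N) → EuclideanSpace ℝ (Fin N)}

theorem tsupport_subset_of_le_posPart {ζ : EuclideanSpace ℝ (Fin N) → ℝ}
    (hζ : ∀ x, 0 ≤ ζ x ∧ ζ x ≤ max (φ x) 0) : tsupport ζ ⊆ tsupport φ := by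
  refine closure_mono fun x hx => ?_
  rw [Function.mem_support] at hx ⊢
  intro h0
  have := hζ x
  rw [h0, max_self] at this
  exact hx (le_antisymm this.2 this.1)

/-- The weak formulation holds for compactly supported bounded test functions in `H¹`. -/
theorem integral_inner_eq_of_memH1Closure (hβ : 0 ≤ β) (hf : IntegrableOn f Ω volume)
    (hu : LocallyBoundedBelow Ω u) (hg : HasH1locGradient Ω u g)
    (hweak : ∀ φ : EuclideanSpace ℝ (Fin N) → ℝ, IsTestFunction 1 Ω φ →
      ∫ x in Ω, inner ℝ (g x) (gradient φ x) = ∫ x in Ω, f x / u x ^ β * φ x)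
    {k : ℕ∞} (hφ : IsTestFunction k Ω φ)
    (H : MemH1Closure (volume.restrict (tsupport φ))
      {ζ | ∀ x, 0 ≤ ζ x ∧ ζ x ≤ max (φ x) 0} z h) :
    IntegrableOn (fun x => f x / u x ^ β * z x) (tsupport φ) volume ∧
      ∫ x in tsupport φ, inner ℝ (g x) (h x) = ∫ x in tsupport φ, f x / u x ^ β * z x := by
  set K := tsupport φ with hKdef
  have hK : IsCompact K := hφ.hasCompactSupport
  have hKΩ : K ⊆ Ω := hφ.tsupport_subset
  obtain ⟨c, hc, hcu⟩ := hu K hK hKΩ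
  obtain ⟨ζ, hP, hC, -, h2, h3⟩ := H.exists_seq
  have hsupp : ∀ n, tsupport (ζ n) ⊆ K := fun n => tsupport_subset_of_le_posPart (hP n)
  obtain ⟨M, hM⟩ := hK.exists_bound_of_continuousOn hφ.contDiff.continuous.continuousOn
  have hζM : ∀ n, ∀ x ∈ K, ‖ζ n x‖ ≤ M := fun n x hx => by
    rw [Real.norm_eq_abs, abs_of_nonneg (hP n x).1]
    refine (hP n x).2.trans (max_le ((le_abs_self _).trans (hM x hx)) ?_)
    exact (norm_nonneg _).trans (hM x hx)
  have hfK : IntegrableOn f K volume := hf.mono_set hKΩ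
  have hum : AEMeasurable u (volume.restrict K) := (hg.memL2loc K hK hKΩ).1.aemeasurable
  -- The singularity is invisible on `K`: there `u ≥ c > 0`, so `|f| / c^β` dominates.
  have hF : IntegrableOn (fun x => f x / u x ^ β) K volume := by
    refine (hfK.norm.div_const (c ^ β)).mono'
      (hfK.1.aemeasurable.div (hum.pow_const β)).aestronglyMeasurable ?_
    filter_upwards [hcu] with x hx
    have hcβ : 0 < c ^ β := Real.rpow_pos_of_pos hc β
    have : c ^ β ≤ u x ^ β := Real.rpow_le_rpow hc.le hx hβ
    rw [norm_div, Real.norm_of_nonneg (hcβ.le.trans this)]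
    gcongr
  have hzM : ∀ᵐ x ∂(volume.restrict K), ‖z x‖ ≤ M := by
    filter_upwards [h3, ae_restrict_mem hK.measurableSet] with x hx hxK
    exact le_of_tendsto hx.norm (Eventually.of_forall fun n => hζM n x hxK)
  refine ⟨hF.mul_bdd H.memLp.1 hzM, ?_⟩
  have t1 := tendsto_integral_inner_const
    (fun n => (continuous_gradient (hC n)).memLp_two_restrict (μ := volume) hK) H.memLp_grad
    (hg.memL2loc_grad K hK hKΩ) h2
  -- `f / u^β` is only `L¹` on `K`, so `L²` convergence of `ζ n` would not suffice; the uniform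
  -- bound `M`, inherited from `φ`, allows dominated convergence.
  have t2 : Tendsto (fun n => ∫ x in K, f x / u x ^ β * ζ n x) atTop
      (𝓝 (∫ x in K, f x / u x ^ β * z x)) := by
    refine tendsto_integral_of_dominated_convergence (fun x => ‖f x / u x ^ β‖ * M)
      (fun n => hF.1.mul (hC n).continuous.aestronglyMeasurable) (hF.norm.mul_const M)
      (fun n => ?_) ?_
    · filter_upwards [ae_restrict_mem hK.measurableSet] with x hxK
      rw [norm_mul]
      gcongr
      exact hζM n x hxK
    · filter_upwards [h3] with x hx
      exact hx.const_mul _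
  have hn : ∀ n, ∫ x in K, inner ℝ (gradient (ζ n) x) (g x)
      = ∫ x in K, f x / u x ^ β * ζ n x := fun n => by
    have h0 : ∀ x ∉ K, gradient (ζ n) x = 0 := fun x hx => by
      rw [gradient, image_eq_zero_of_notMem_tsupport (f := fderiv ℝ (ζ n))
        fun h => hx (hsupp n (tsupport_fderiv_subset ℝ h)), map_zero]
    have h0' : ∀ x ∉ K, ζ n x = 0 := fun x hx =>
      image_eq_zero_of_notMem_tsupport fun h => hx (hsupp n h)
    have hw := hweak (ζ n) ⟨hC n, hK.of_isClosed_subset (isClosed_tsupport _) (hsupp n),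
      (hsupp n).trans hKΩ⟩
    rw [setIntegral_eq_integral_of_forall_compl_eq_zero
        (fun x hx => by simp [h0 x fun h => hx (hKΩ h)]),
      setIntegral_eq_integral_of_forall_compl_eq_zero
        (fun x hx => by simp [h0' x fun h => hx (hKΩ h)])] at hw
    rw [setIntegral_eq_integral_of_forall_compl_eq_zero (fun x hx => by simp [h0 x hx]),
      setIntegral_eq_integral_of_forall_compl_eq_zero (fun x hx => by simp [h0' x hx]), ← hw]
    simp only [real_inner_comm]
  simp only [hn] at t1
  rw [← tendsto_nhds_unique t1 t2]
  simp only [real_inner_comm]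

end WeakForm

/-! ### Energy estimate and comparison principle -/

section Comparison

variable {N : ℕ} {Ω K : Set (EuclideanSpace ℝ (Fin N))}
  {f u v z φ : EuclideanSpace ℝ (Fin N) → ℝ} {β ε : ℝ}
  {g g' h G : EuclideanSpace ℝ (Fin N) → EuclideanSpace ℝ (Fin N)}

theorem hasCompactSupport_gradient (hφ : HasCompactSupport φ) : HasCompactSupport (gradient φ) :=
  (hφ.fderiv ℝ).comp_left (map_zero (InnerProductSpace.toDual ℝ _).symm)

/-- The positive part of `min φ (u - ε) - v`. -/
noncomputable def cutDiff (u v φ : EuclideanSpace ℝ (Fin N) → ℝ) (ε : ℝ)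
    (x : EuclideanSpace ℝ (Fin N)) : ℝ :=
  max (φ x - v x - max (φ x - (u x - ε)) 0) 0

/-- The weak gradient of `cutDiff u v φ ε`, if `g = ∇u` and `g' = ∇v`. -/
noncomputable def cutDiffGrad (u v φ : EuclideanSpace ℝ (Fin N) → ℝ)
    (g g' : EuclideanSpace ℝ (Fin N) → EuclideanSpace ℝ (Fin N)) (ε : ℝ) :
    EuclideanSpace ℝ (Fin N) → EuclideanSpace ℝ (Fin N) :=
  Set.indicator {x | 0 < φ x - v x - max (φ x - (u x - ε)) 0} fun x =>
    gradient φ x - g' x - Set.indicator {x | 0 < φ x - (u x - ε)}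
      (fun x => gradient φ x - g x) x

/-- Writing `min(φ, u - ε)` as `φ - (φ - (u - ε))⁺` leaves only differences and positive parts.
Approximants of `v` and of the inner positive part are nonnegative, so subtracting them from `φ`
stays below `φ`; the outer positive part then yields the two-sided bound. -/
theorem memH1Closure_cutDiff (hΩ : IsOpen Ω) (hu : HasH1locGradient Ω u g)
    (hv : HasH1locGradient Ω v g') (hv0 : ∀ᵐ x ∂(volume.restrict Ω), 0 ≤ v x)
    {k : ℕ∞} (hk : 1 ≤ k) (hφ : IsTestFunction k Ω φ) :
    MemH1Closure (volume.restrict (tsupport φ)) {ζ | ∀ x, 0 ≤ ζ x ∧ ζ x ≤ max (φ x) 0}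
      (cutDiff u v φ ε) (cutDiffGrad u v φ g g' ε) := by
  have hK : IsCompact (tsupport φ) := hφ.hasCompactSupport
  have : IsFiniteMeasure (volume.restrict (tsupport φ)) := ⟨by simpa using hK.measure_lt_top⟩
  have hφC : ContDiff ℝ 1 φ := hφ.contDiff.of_le (by exact_mod_cast hk)
  have Hφ := memH1Closure_of_contDiff (μ := volume) (P := {φ}) hφC rfl hK
  have Hv : MemH1Closure (volume.restrict (tsupport φ)) {ζ | ∀ x, 0 ≤ ζ x} v g' :=
    (hv.memH1Closure hΩ hK hφ.tsupport_subset).mono fun ζ hζ => hζ hv0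
  have Hu := (hu.memH1Closure hΩ hK hφ.tsupport_subset).sub_const hK ε
  have Hφv := Hφ.sub (R := {ζ | ∀ x, ζ x ≤ φ x}) Hv fun p hp q hq x => by
    rw [Set.mem_singleton_iff.1 hp]
    linarith [hq x]
  have HB := (Hφ.sub (R := Set.univ) Hu fun _ _ _ _ => Set.mem_univ _).posPart
    (Q := {ζ | ∀ x, 0 ≤ ζ x}) fun δ hδ p _ x => smoothPosPart_nonneg hδ _
  have HA := Hφv.sub (R := {ζ | ∀ x, ζ x ≤ φ x}) HB fun p hp q hq x => by
    linarith [hp x, hq x]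
  exact HA.posPart fun δ hδ p hp x => ⟨smoothPosPart_nonneg hδ _,
    (smoothPosPart_le_max hδ _).trans (max_le_max (hp x) le_rfl)⟩

theorem lt_of_cutDiff_pos {x : EuclideanSpace ℝ (Fin N)}
    (hx : 0 < φ x - v x - max (φ x - (u x - ε)) 0) : v x < u x - ε := by
  rcases le_total (φ x - (u x - ε)) 0 with h | h
  · rw [max_eq_right h] at hx; linarith
  · rw [max_eq_left h] at hx; linarith

/-- Put `p = g - g'`. Where `cutDiff` is positive, its gradient is `p + d`, with `d = 0` if `φ > u -
ε` and `d = ∇φ - g` otherwise. There `u > v + ε ≥ ε`, so `g = G`. The bound is then `½|p + d|² -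
½|d|² ≤ p · (p + d)`, that is, `½|p|² ≥ 0`. -/
theorem sq_cutDiffGrad_sub_le {x : EuclideanSpace ℝ (Fin N)} (hv : 0 ≤ v x)
    (hG : ε < u x → G x = g x) :
    1 / 2 * inner ℝ (cutDiffGrad u v φ g g' ε x) (cutDiffGrad u v φ g g' ε x)
        - 1 / 2 * inner ℝ (gradient φ x - G x) (gradient φ x - G x)
      ≤ inner ℝ (g x) (cutDiffGrad u v φ g g' ε x)
        - inner ℝ (g' x) (cutDiffGrad u v φ g g' ε x) := by
  have aux : ∀ p d : EuclideanSpace ℝ (Fin N),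
      1 / 2 * inner ℝ (p + d) (p + d) - 1 / 2 * inner ℝ d d ≤ inner ℝ p (p + d) := fun p d => by
    have h1 : (0 : ℝ) ≤ inner ℝ p p := real_inner_self_nonneg
    simp only [inner_add_left, inner_add_right, real_inner_comm p d]
    linarith
  have hD : (0 : ℝ) ≤ inner ℝ (gradient φ x - G x) (gradient φ x - G x) :=
    real_inner_self_nonneg
  rw [cutDiffGrad, ← inner_sub_left]
  by_cases hA : 0 < φ x - v x - max (φ x - (u x - ε)) 0
  · rw [Set.indicator_of_mem (by exact hA)]
    have hlt := lt_of_cutDiff_pos hA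
    by_cases hB : 0 < φ x - (u x - ε)
    · rw [Set.indicator_of_mem (by exact hB)]
      have := aux (g x - g' x) 0
      rw [add_zero, inner_zero_left] at this
      rw [show gradient φ x - g' x - (gradient φ x - g x) = g x - g' x by abel]
      linarith
    · rw [Set.indicator_of_notMem (by exact hB), sub_zero, hG (by linarith)]
      have := aux (g x - g' x) (gradient φ x - g x)
      rwa [show g x - g' x + (gradient φ x - g x) = gradient φ x - g' x by abel] at this
  · rw [Set.indicator_of_notMem (by exact hA)]
    simp only [inner_zero_right]
    linarith

theorem integrable_inner_of_memLp {α F : Type*} [MeasurableSpace α] {μ : Measure α}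
    [NormedAddCommGroup F] [InnerProductSpace ℝ F] {p q : α → F} (hp : MemLp p 2 μ)
    (hq : MemLp q 2 μ) : Integrable (fun x => inner ℝ (p x) (q x)) μ := by
  refine (L2.integrable_inner (𝕜 := ℝ) (hp.toLp p) (hq.toLp q)).congr ?_
  filter_upwards [hp.coeFn_toLp, hq.coeFn_toLp] with x h1 h2
  rw [h1, h2]

/-- Energy estimate for the difference of two weak solutions, obtained by testing both equations
with `cutDiff u v φ ε`. -/
theorem integral_sq_cutDiffGrad_le (hΩ : IsOpen Ω) (hβ : 0 ≤ β) (hf : IntegrableOn f Ω volume)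
    (hf0 : ∀ᵐ x ∂(volume.restrict Ω), 0 ≤ f x) (hε : 0 ≤ ε)
    (hub : LocallyBoundedBelow Ω u) (hvb : LocallyBoundedBelow Ω v)
    (hu : HasH1locGradient Ω u g) (hv : HasH1locGradient Ω v g')
    (hv0 : ∀ᵐ x ∂(volume.restrict Ω), 0 ≤ v x)
    (hue : ∀ φ : EuclideanSpace ℝ (Fin N) → ℝ, IsTestFunction 1 Ω φ →
      ∫ x in Ω, inner ℝ (g x) (gradient φ x) = ∫ x in Ω, f x / u x ^ β * φ x)
    (hve : ∀ φ : EuclideanSpace ℝ (Fin N) → ℝ, IsTestFunction 1 Ω φ →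
      ∫ x in Ω, inner ℝ (g' x) (gradient φ x) = ∫ x in Ω, f x / v x ^ β * φ x)
    (hGm : MemLp G 2 (volume.restrict Ω))
    (hG : ∀ᵐ x ∂(volume.restrict Ω), ε < u x → G x = g x)
    {k : ℕ∞} (hk : 1 ≤ k) (hφ : IsTestFunction k Ω φ) :
    ∫ x in tsupport φ, inner ℝ (cutDiffGrad u v φ g g' ε x) (cutDiffGrad u v φ g g' ε x)
      ≤ ∫ x in Ω, inner ℝ (gradient φ x - G x) (gradient φ x - G x) := by
  have hK : IsCompact (tsupport φ) := hφ.hasCompactSupport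
  have hKΩ : tsupport φ ⊆ Ω := hφ.tsupport_subset
  have hφC : ContDiff ℝ 1 φ := hφ.contDiff.of_le (by exact_mod_cast hk)
  have H := memH1Closure_cutDiff (ε := ε) hΩ hu hv hv0 hk hφ
  obtain ⟨iu, eu⟩ := integral_inner_eq_of_memH1Closure hβ hf hub hu hue hφ H
  obtain ⟨iv, ev⟩ := integral_inner_eq_of_memH1Closure hβ hf hvb hv hve hφ H
  obtain ⟨c, hc, hcv⟩ := hvb _ hK hKΩ
  have hle : volume.restrict (tsupport φ) ≤ volume.restrict Ω := Measure.restrict_mono_set _ hKΩ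
  have hgc : HasCompactSupport (gradient φ) := hasCompactSupport_gradient hφ.hasCompactSupport
  have hDm : MemLp (fun x => gradient φ x - G x) 2 (volume.restrict Ω) :=
    (((continuous_gradient hφC).memLp_of_hasCompactSupport hgc).restrict Ω).sub hGm
  -- Monotonicity of the source: where `cutDiff` is positive, `0 < v < u - ε ≤ u`, hence `f / u^β ≤
  -- f / v^β`; elsewhere both integrands vanish.
  have hsource : ∫ x in tsupport φ, f x / u x ^ β * cutDiff u v φ ε x
      ≤ ∫ x in tsupport φ, f x / v x ^ β * cutDiff u v φ ε x := by
    refine integral_mono_ae iu iv ?_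
    filter_upwards [hcv, ae_mono hle hf0] with x hx hfx
    simp only [cutDiff]
    by_cases hA : 0 < φ x - v x - max (φ x - (u x - ε)) 0
    · have hlt := lt_of_cutDiff_pos hA
      have hvx : 0 < v x := hc.trans_le hx
      have h1 : v x ^ β ≤ u x ^ β := Real.rpow_le_rpow hvx.le (by linarith) hβ
      have h2 : 0 < v x ^ β := Real.rpow_pos_of_pos hvx β
      gcongr
    · rw [max_eq_right (not_lt.1 hA), mul_zero, mul_zero]
  have hgu := (hu.memL2loc_grad _ hK hKΩ)
  have hgv := (hv.memL2loc_grad _ hK hKΩ)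
  have hDK := hDm.mono_measure hle
  have hI := fun {p q : EuclideanSpace ℝ (Fin N) → EuclideanSpace ℝ (Fin N)}
    (hp : MemLp p 2 (volume.restrict (tsupport φ))) (hq : MemLp q 2 (volume.restrict (tsupport φ))) =>
    integrable_inner_of_memLp hp hq
  have hmain := integral_mono_ae
    (((hI H.memLp_grad H.memLp_grad).const_mul (1 / 2)).sub ((hI hDK hDK).const_mul (1 / 2)))
    ((hI hgu H.memLp_grad).sub (hI hgv H.memLp_grad))
    (by
      filter_upwards [hcv, ae_mono hle hG] with x hx hGx
      exact sq_cutDiffGrad_sub_le (hc.le.trans hx) hGx)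
  simp only [Pi.sub_apply] at hmain
  rw [integral_sub ((hI H.memLp_grad H.memLp_grad).const_mul _) ((hI hDK hDK).const_mul _),
    integral_sub (hI hgu H.memLp_grad) (hI hgv H.memLp_grad), integral_const_mul,
    integral_const_mul, eu, ev] at hmain
  have hmono : ∫ x in tsupport φ, inner ℝ (gradient φ x - G x) (gradient φ x - G x)
      ≤ ∫ x in Ω, inner ℝ (gradient φ x - G x) (gradient φ x - G x) :=
    setIntegral_mono_set (integrable_inner_of_memLp hDm hDm)
      (Eventually.of_forall fun x => real_inner_self_nonneg) (Eventually.of_forall hKΩ)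
  linarith

theorem eLpNorm_two_eq_ofReal_sqrt {α F : Type*} [MeasurableSpace α] {μ : Measure α}
    [NormedAddCommGroup F] [InnerProductSpace ℝ F] {p : α → F} (hp : MemLp p 2 μ) :
    eLpNorm p 2 μ = ENNReal.ofReal (√(∫ x, inner ℝ (p x) (p x) ∂μ)) := by
  rw [hp.eLpNorm_eq_integral_rpow_norm (by norm_num) (by norm_num), Real.sqrt_eq_rpow]
  simp

/-- Comparison principle. -/
theorem ae_sub_le_of_isWeakSolution (hN : 1 ≤ N) (hΩ : IsOpen Ω) (hΩb : Bornology.IsBounded Ω)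
    (hβ : 0 ≤ β) (hf : IntegrableOn f Ω volume)
    (hf0 : ∀ᵐ x ∂(volume.restrict Ω), 0 ≤ f x) (hε : 0 < ε)
    (hu : IsWeakSolution Ω f β u) (hub : BoundaryNonpos Ω u)
    (hv : IsWeakSolution Ω f β v) (hv0 : ∀ᵐ x ∂(volume.restrict Ω), 0 ≤ v x) :
    ∀ᵐ x ∂(volume.restrict Ω), u x - ε ≤ v x := by
  obtain ⟨hub', g, hug, hue⟩ := hu
  obtain ⟨hvb', g', hvg, hve⟩ := hv
  obtain ⟨G, hwm, hGm, hGw, φ, hφ, hφ1, hφ2⟩ := hub ε hε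
  have hG := hug.ae_eq_grad_posPart hΩ hGw
  obtain ⟨R, hR⟩ := hΩb.subset_closedBall (0 : EuclideanSpace ℝ (Fin N))
  have hR' : Ω ⊆ Metric.closedBall 0 (max R 0) :=
    hR.trans (Metric.closedBall_subset_closedBall (le_max_left _ _))
  set S := max R 0
  have hS : 0 ≤ S := le_max_right _ _
  have hum : AEStronglyMeasurable u (volume.restrict Ω) :=
    hug.isWeakGradient.locallyIntegrableOn.aestronglyMeasurable
  have hvm : AEStronglyMeasurable v (volume.restrict Ω) :=
    hvg.isWeakGradient.locallyIntegrableOn.aestronglyMeasurable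
  have hφm : ∀ n, AEStronglyMeasurable (φ n) (volume.restrict Ω) := fun n =>
    (hφ n).contDiff.continuous.aestronglyMeasurable
  have hzm : ∀ n, AEStronglyMeasurable (cutDiff u v (φ n) ε) (volume.restrict Ω) := fun n =>
    (((hφm n).sub hvm).sub (((hφm n).sub (hum.sub aestronglyMeasurable_const)).sup
      aestronglyMeasurable_const)).sup aestronglyMeasurable_const
  -- Poincaré on `tsupport (φ n)` followed by the energy estimate. The radius `S` comes from `Ω`, so
  -- the constant does not depend on `n`.
  have hbound : ∀ n, eLpNorm (cutDiff u v (φ n) ε) 2 (volume.restrict Ω)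
      ≤ ENNReal.ofReal (2 * S) *
        eLpNorm (fun x => gradient (φ n) x - G x) 2 (volume.restrict Ω) := by
    intro n
    have hK : IsCompact (tsupport (φ n)) := (hφ n).hasCompactSupport
    have hKΩ : tsupport (φ n) ⊆ Ω := (hφ n).tsupport_subset
    have H := memH1Closure_cutDiff (ε := ε) hΩ hug hvg hv0 le_top (hφ n)
    have h1 := H.integral_sq_le hN hS (hKΩ.trans hR') hK
      fun ζ hζ => tsupport_subset_of_le_posPart hζ
    have h2 := integral_sq_cutDiffGrad_le hΩ hβ hf hf0 hε.le hub' hvb' hug hvg hv0 hue hve hGm hG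
      le_top (hφ n)
    have hφC : ContDiff ℝ 1 (φ n) := (hφ n).contDiff.of_le (by exact_mod_cast le_top)
    have hgc : HasCompactSupport (gradient (φ n)) :=
      hasCompactSupport_gradient (hφ n).hasCompactSupport
    have hDm : MemLp (fun x => gradient (φ n) x - G x) 2 (volume.restrict Ω) :=
      (((continuous_gradient hφC).memLp_of_hasCompactSupport hgc).restrict Ω).sub hGm
    -- Off the support of `φ n`, `cutDiff` is zero because `v ≥ 0`.
    have hz : eLpNorm (cutDiff u v (φ n) ε) 2 (volume.restrict Ω)
        = eLpNorm (cutDiff u v (φ n) ε) 2 (volume.restrict (tsupport (φ n))) := by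
      rw [← Measure.restrict_restrict_of_subset hKΩ,
        ← eLpNorm_indicator_eq_eLpNorm_restrict hK.measurableSet]
      refine eLpNorm_congr_ae ?_
      filter_upwards [hv0] with x hx
      by_cases hxK : x ∈ tsupport (φ n)
      · rw [Set.indicator_of_mem hxK]
      · rw [Set.indicator_of_notMem hxK, cutDiff, image_eq_zero_of_notMem_tsupport hxK]
        refine max_eq_right ?_
        linarith [le_max_right (0 - (u x - ε)) 0]
    rw [hz, eLpNorm_two_eq_ofReal_sqrt H.memLp, eLpNorm_two_eq_ofReal_sqrt hDm,
      ← ENNReal.ofReal_mul (by positivity)]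
    refine ENNReal.ofReal_le_ofReal ?_
    refine (Real.sqrt_le_sqrt (h1.trans (mul_le_mul_of_nonneg_left h2 (by positivity)))).trans ?_
    rw [show 4 * S ^ 2 = (2 * S) ^ 2 by ring, Real.sqrt_mul (by positivity),
      Real.sqrt_sq (by positivity)]
  have hz0 : Tendsto (fun n => eLpNorm (fun x => cutDiff u v (φ n) ε x - (0 : ℝ)) 2
      (volume.restrict Ω)) atTop (𝓝 0) := by
    simp only [sub_zero]
    have := ENNReal.Tendsto.const_mul (a := ENNReal.ofReal (2 * S)) hφ2
      (Or.inr ENNReal.ofReal_ne_top)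
    rw [mul_zero] at this
    exact tendsto_of_tendsto_of_tendsto_of_le_of_le tendsto_const_nhds this (fun _ => zero_le)
      hbound
  obtain ⟨ns, hns, hae1⟩ := exists_subseq_tendsto_ae hφm hwm.1 hφ1
  obtain ⟨ms, hms, hae2⟩ := exists_subseq_tendsto_ae (fun n => hzm (ns n))
    aestronglyMeasurable_const (hz0.comp hns.tendsto_atTop)
  filter_upwards [hae1, hae2, hv0] with x h1 h2 hx
  have h1' := h1.comp hms.tendsto_atTop
  -- As `min((u - ε)⁺, u - ε) = u - ε`, the pointwise limit is `(u - ε - v)⁺`; it must agree with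
  -- the limit `0` obtained from `L²` convergence.
  have h3 : Tendsto (fun n => cutDiff u v (φ (ns (ms n))) ε x) atTop
      (𝓝 (max (max (u x - ε) 0 - v x - max (max (u x - ε) 0 - (u x - ε)) 0) 0)) :=
    ((h1'.sub_const _).sub ((h1'.sub_const _).max tendsto_const_nhds)).max tendsto_const_nhds
  have h4 := tendsto_nhds_unique h3 h2
  have h5 := (le_max_left _ _).trans h4.le
  rcases le_total (u x - ε) 0 with ha | ha
  · linarith
  · rw [max_eq_left ha, sub_self, max_self] at h5
    linarith

theorem ae_le_of_isWeakSolution (hN : 1 ≤ N) (hΩ : IsOpen Ω) (hΩb : Bornology.IsBounded Ω)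
    (hβ : 0 ≤ β) (hf : IntegrableOn f Ω volume)
    (hf0 : ∀ᵐ x ∂(volume.restrict Ω), 0 ≤ f x)
    (hu : IsWeakSolution Ω f β u) (hub : BoundaryNonpos Ω u)
    (hv : IsWeakSolution Ω f β v) (hv0 : ∀ᵐ x ∂(volume.restrict Ω), 0 ≤ v x) :
    ∀ᵐ x ∂(volume.restrict Ω), u x ≤ v x := by
  have h := ae_all_iff.2 fun n : ℕ => ae_sub_le_of_isWeakSolution hN hΩ hΩb hβ hf hf0
    (Nat.one_div_pos_of_nat (α := ℝ) (n := n)) hu hub hv hv0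
  filter_upwards [h] with x hx
  have ht : Tendsto (fun n : ℕ => u x - 1 / ((n : ℝ) + 1)) atTop (𝓝 (u x - 0)) :=
    tendsto_const_nhds.sub tendsto_one_div_add_atTop_nhds_zero_nat
  rw [sub_zero] at ht
  exact le_of_tendsto' ht hx

end Comparison

end SingularElliptic

theorem theorem1p2 {N : ℕ} (hN : 1 ≤ N) (β : ℝ) (hβ : 1 < β)
    (Ω : Set (EuclideanSpace ℝ (Fin N))) (hΩ_open : IsOpen Ω) (hΩ_bdd : Bornology.IsBounded Ω)
    (f : EuclideanSpace ℝ (Fin N) → ℝ) (hf : IntegrableOn f Ω volume)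
    (hf_nonneg : ∀ᵐ x ∂(volume.restrict Ω), 0 ≤ f x)
    (u v : EuclideanSpace ℝ (Fin N) → ℝ)
    (hu : SingularElliptic.IsWeakSolution Ω f β u) (hu_bd : SingularElliptic.ZeroOnBoundary Ω u)
    (hv : SingularElliptic.IsWeakSolution Ω f β v) (hv_bd : SingularElliptic.ZeroOnBoundary Ω v) :
    ∀ᵐ x ∂(volume.restrict Ω), u x = v x := by
  have hβ0 : 0 ≤ β := by linarith
  filter_upwards [SingularElliptic.ae_le_of_isWeakSolution hN hΩ_open hΩ_bdd hβ0 hf hf_nonneg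
      hu hu_bd.2 hv hv_bd.1,
    SingularElliptic.ae_le_of_isWeakSolution hN hΩ_open hΩ_bdd hβ0 hf hf_nonneg
      hv hv_bd.2 hu hu_bd.1] with x h1 h2
  exact le_antisymm h1 h2
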